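/- Let $n\ge 1$ and let $D\subset\mathbb C^n$ be a bounded domain (a nonempty bounded connected open set), and let $B^n$ denote the open Euclidean unit ball of $\mathbb C^n$ and $B^n(0,r)$ the open ball of radius $r$ centred at $0$. For $z\in D$, the squeezing function of $D$ is $$s_D(z)=\sup_f\ \sup\{r>0 : B^n(0,r)\subset f(D)\},$$ where $f$ runs over all (open) holomorphic embeddings $f:D\to B^n$ with $f(z)=0$. A point $p\in\partial D$ is called a globally strongly convex boundary point of $D$ if $\partial D$ is $C^2$-smooth and strongly convex at $p$, i.e. there are an open neighbourhood $U$ of $p$ and a $C^2$ function $\rho:U\to\mathbb R$ with $d\rho\neq 0$ on $U$ and $D\cap U=\{z\in U:\rho(z)<0\}$ such that the real Hessian of $\rho$ at $p$ is positive definite on the real tangent space $\ker d\rho_p$, and moreover $$\overline D\cap T_p\partial D=\{p\},\qquad T_p\partial D=\{z\in\mathbb C^n : d\rho_p(z-p)=0\},$$ where $T_p\partial D$ is the (real) tangent hyperplane of $\partial D$ at $p$. If $p\in\partial D$ is a globally strongly convex boundary point of $D$, then $$\lim_{D\ni z\to p}s_D(z)=1.$$ -/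

import Mathlib

open Set Topology

noncomputable section

/-- `ℂⁿ` with its Euclidean norm. -/
abbrev Cn (n : ℕ) : Type := EuclideanSpace ℂ (Fin n)

/-- A bounded domain in `ℂⁿ`: a bounded, open, connected (in particular nonempty) set. -/
structure IsBoundedDomain {n : ℕ} (D : Set (Cn n)) : Prop where
  isOpen : IsOpen D
  isConnected : IsConnected D
  isBounded : Bornology.IsBounded D

/-- `ρ` is a `C²` local defining function of `D` on the open neighbourhood `U` of `p`
(differentiability is over `ℝ`). -/
structure IsC2DefiningFunction {n : ℕ} (D : Set (Cn n)) (p : Cn n) (U : Set (Cn n))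
    (ρ : Cn n → ℝ) : Prop where
  isOpen : IsOpen U
  mem : p ∈ U
  contDiffOn : ContDiffOn ℝ 2 ρ U
  fderiv_ne_zero : ∀ z ∈ U, fderiv ℝ ρ z ≠ 0
  inter_eq : D ∩ U = {z ∈ U | ρ z < 0}

/-- The real affine hyperplane `{z | dρ_p (z - p) = 0}`. When `ρ` is a defining function of `D`
near `p`, this is the tangent hyperplane of the boundary of `D` at `p`. -/
def tangentHyperplane {n : ℕ} (ρ : Cn n → ℝ) (p : Cn n) : Set (Cn n) :=
  {z | fderiv ℝ ρ p (z - p) = 0}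

/-- The real Hessian of `ρ` at `p` is positive definite on the tangent space `ker dρ_p`. -/
def HessianPosDefOnTangent {n : ℕ} (ρ : Cn n → ℝ) (p : Cn n) : Prop :=
  ∀ v : Cn n, v ≠ 0 → fderiv ℝ ρ p v = 0 → 0 < fderiv ℝ (fderiv ℝ ρ) p v v

/-- `p` is a globally strongly convex boundary point of `D`: the boundary of `D` is `C²` near `p`
and strongly convex at `p`, and the closure of `D` meets the tangent hyperplane at `p` only in `p`.
Neither the positivity of the Hessian on the tangent space nor the tangent hyperplane depends
on the choice of the defining function. -/
def IsGloballyStronglyConvexPoint {n : ℕ} (D : Set (Cn n)) (p : Cn n) : Prop :=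
  p ∈ frontier D ∧ ∃ (U : Set (Cn n)) (ρ : Cn n → ℝ),
    IsC2DefiningFunction D p U ρ ∧ HessianPosDefOnTangent ρ p ∧
      closure D ∩ tangentHyperplane ρ p = {p}

/-- `f` restricts to an (open) holomorphic embedding of `D` into the unit ball
taking `z` to `0`. -/
structure IsEmbeddingIntoBall {n : ℕ} (D : Set (Cn n)) (z : Cn n) (f : Cn n → Cn n) : Prop where
  differentiableOn : DifferentiableOn ℂ f D
  fderiv_injective : ∀ x ∈ D, Function.Injective (fderiv ℂ f x)
  isOpenEmbedding : IsOpenEmbedding (D.domRestrict f)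
  mapsTo : MapsTo f D (Metric.ball 0 1)
  map_eq_zero : f z = 0

/-- `s_D(z, f) = sup {r > 0 | B(0, r) ⊆ f(D)}`. -/
def squeezingNumberOf {n : ℕ} (D : Set (Cn n)) (f : Cn n → Cn n) : ℝ :=
  sSup {r : ℝ | 0 < r ∧ Metric.ball (0 : Cn n) r ⊆ f '' D}

/-- The squeezing function `s_D(z) = sup_f s_D(z, f)`, the supremum being over all holomorphic
embeddings `f` of `D` into the unit ball with `f z = 0`. -/
def squeezingFunction {n : ℕ} (D : Set (Cn n)) (z : Cn n) : ℝ :=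
  sSup {s : ℝ | ∃ f : Cn n → Cn n, IsEmbeddingIntoBall D z f ∧ s = squeezingNumberOf D f}

end

/-! For `z` near `p`, move along a fixed transversal direction `e` to a boundary point `x = z + t •
e`. Strong convexity near `p` and compactness away from it put `D` on one side of the real
hyperplane `ker dρ_x` through `x`. In complex linear coordinates `(a, w)` at `x` with `re a = dρ_x`,
this says `re a < 0` on `D`. Moreover `re a ≤ -δ` away from `x`, while close to `x` the domain is
squeezed between small perturbations of the quadric `re a + re Q(w) + ‖w‖² < 0`, uniformly in `x`.

The shear `a ↦ a + Q(w)` would turn the quadric into the Siegel domain `re a + ‖w‖² < 0`, but it may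
ruin the far part of `D`. So `w` is first replaced by `k(a) • w`, where `k` is holomorphic on the
half-plane, close to `1` near `0`, almost positive real, and tiny for `re a ≤ -δ`. Near `x` this
costs only a small error, because `Q(kw) = k²Q(w)` and `k² ≈ |k|²`; far from `x` both `Q(kw)` and
`‖kw‖²` become negligible against `δ`. A Cayley transform at scale `t` then sends `D` into the ball
of radius `1 + η`, with image containing the ball of radius `1 - η`
(`exists_holEmb_of_near_quadric`). The point `z` goes within `η` of the centre, so a translation and
a dilation give an embedding into the unit ball with `s_D(z) ≥ (1 - 2η)/(1 + 2η)`
(`IsGloballyStronglyConvexPoint.eventually_exists_holEmb`).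

The geometric input comes from `ContDiffAt.exists_uniform_chart`, `exists_fderiv_neg_of_neg` and
`IsC2DefiningFunction.exists_fderiv_sub_le_neg`. -/

/-! ### Holomorphic embeddings with a holomorphic left inverse -/

/-- `f` is a holomorphic embedding of `D`: it is holomorphic on `D` and has a holomorphic left
inverse on an open set containing `f '' D`, which is also a right inverse at the points that it
sends into `D`. -/
def HolEmb {E F : Type*} [NormedAddCommGroup E] [NormedSpace ℂ E] [NormedAddCommGroup F]
    [NormedSpace ℂ F] (f : E → F) (D : Set E) : Prop :=
  DifferentiableOn ℂ f D ∧ ∃ (g : F → E) (V : Set F), IsOpen V ∧ MapsTo f D V ∧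
    DifferentiableOn ℂ g V ∧ (∀ x ∈ D, g (f x) = x) ∧ ∀ y ∈ V, g y ∈ D → f (g y) = y

section HolEmb

variable {E F G : Type*} [NormedAddCommGroup E] [NormedSpace ℂ E] [NormedAddCommGroup F]
    [NormedSpace ℂ F] [NormedAddCommGroup G] [NormedSpace ℂ G]

theorem HolEmb.mono {f : E → F} {D D' : Set E} (h : HolEmb f D) (hD : D' ⊆ D) : HolEmb f D' := by
  obtain ⟨hf, g, V, hV, hm, hg, h1, h2⟩ := h
  exact ⟨hf.mono hD, g, V, hV, hm.mono_left hD, hg, fun x hx => h1 x (hD hx),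
    fun y hy hgy => h2 y hy (hD hgy)⟩

theorem HolEmb.comp {f₁ : E → F} {f₂ : F → G} {D : Set E} {D₂ : Set F} (h₂ : HolEmb f₂ D₂)
    (h₁ : HolEmb f₁ D) (hm : MapsTo f₁ D D₂) (hD₂ : IsOpen D₂) : HolEmb (f₂ ∘ f₁) D := by
  obtain ⟨hf₁, g₁, V₁, hV₁, hm₁, hg₁, hl₁, hr₁⟩ := h₁
  obtain ⟨hf₂, g₂, V₂, hV₂, hm₂, hg₂, hl₂, hr₂⟩ := h₂
  -- Requiring `g₂ y ∈ D₂` is what makes `f₂ (g₂ y) = y` available for the composite.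
  refine ⟨hf₂.comp hf₁ hm, g₁ ∘ g₂, V₂ ∩ g₂ ⁻¹' (V₁ ∩ D₂),
    hg₂.continuousOn.isOpen_inter_preimage hV₂ (hV₁.inter hD₂), ?_, ?_, ?_, ?_⟩
  · intro x hx
    refine ⟨hm₂ (hm hx), ?_⟩
    simp only [mem_preimage, Function.comp, hl₂ _ (hm hx)]
    exact ⟨hm₁ hx, hm hx⟩
  · exact hg₁.comp (hg₂.mono inter_subset_left) fun y hy => hy.2.1
  · intro x hx
    simp only [Function.comp, hl₂ _ (hm hx), hl₁ x hx]
  · rintro y ⟨hy, hy₁, hy₂⟩ hyD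
    simp only [Function.comp] at hyD ⊢
    rw [hr₁ _ hy₁ hyD, hr₂ y hy hy₂]

theorem ContinuousLinearEquiv.holEmb (e : E ≃L[ℂ] F) (D : Set E) : HolEmb e D :=
  ⟨e.differentiable.differentiableOn, e.symm, univ, isOpen_univ, mapsTo_univ _ _,
    e.symm.differentiable.differentiableOn, by simp, by simp⟩

theorem holEmb_sub_const (v : E) (D : Set E) : HolEmb (fun x => x - v) D :=
  ⟨by fun_prop, fun x => x + v, univ, isOpen_univ, mapsTo_univ _ _, by fun_prop, by simp, by simp⟩

theorem holEmb_const_smul {c : ℂ} (hc : c ≠ 0) (D : Set E) : HolEmb (fun x => c • x) D :=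
  ⟨by fun_prop, fun x => c⁻¹ • x, univ, isOpen_univ, mapsTo_univ _ _, by fun_prop,
    by simp [smul_smul, hc], by simp [smul_smul, hc]⟩

/-- Differentiating `g ∘ f = id` gives a left inverse of the derivative. -/
theorem HolEmb.fderiv_injective {f : E → F} {D : Set E} (h : HolEmb f D) (hD : IsOpen D) :
    ∀ x ∈ D, Function.Injective (fderiv ℂ f x) := by
  obtain ⟨hf, g, V, hV, hm, hg, hl, hr⟩ := h
  intro x hx
  have hfx := (hf.differentiableAt (hD.mem_nhds hx)).hasFDerivAt
  have hgx := (hg.differentiableAt (hV.mem_nhds (hm hx))).hasFDerivAt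
  have hid : HasFDerivAt (g ∘ f) (ContinuousLinearMap.id ℂ E) x :=
    (hasFDerivAt_id x).congr_of_eventuallyEq (by
      filter_upwards [hD.mem_nhds hx] with y hy using hl y hy)
  have := (hgx.comp x hfx).unique hid
  intro v w hvw
  have h1 := DFunLike.congr_fun this v
  have h2 := DFunLike.congr_fun this w
  simp only [ContinuousLinearMap.comp_apply, ContinuousLinearMap.id_apply] at h1 h2
  rw [← h1, ← h2, hvw]

/-- The image of an open `O ⊆ D` is `V ∩ g ⁻¹' O`, which is open by continuity of `g`. -/
theorem HolEmb.isOpenEmbedding {f : E → F} {D : Set E} (h : HolEmb f D) (hD : IsOpen D) :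
    IsOpenEmbedding (D.domRestrict f) := by
  obtain ⟨hf, g, V, hV, hm, hg, hl, hr⟩ := h
  refine .of_continuous_injective_isOpenMap hf.continuousOn.domRestrict ?_ ?_
  · intro x y hxy
    ext
    have : f x = f y := hxy
    rw [← hl x x.2, ← hl y y.2, this]
  · intro O hO
    have hO' := hD.isOpenMap_subtype_val O hO
    have : D.domRestrict f '' O = V ∩ g ⁻¹' (Subtype.val '' O) := by
      ext y
      constructor
      · rintro ⟨x, hx, rfl⟩
        refine ⟨hm x.2, ?_⟩
        simp only [mem_preimage, Set.domRestrict_apply, hl x x.2]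
        exact ⟨x, hx, rfl⟩
      · rintro ⟨hy, x, hx, hxy⟩
        refine ⟨x, hx, ?_⟩
        have hgD : g y ∈ D := hxy ▸ x.2
        simp only [Set.domRestrict_apply, hxy, hr y hy hgD]
    rw [this]
    exact hg.continuousOn.isOpen_inter_preimage hV hO'

end HolEmb

/-! ### The damping function -/

/-- A holomorphic function on the left half-plane, equal to `1` at `0`, of modulus at most `1`,
of small argument, and small at the points of real part at most `-δ`. -/
theorem exists_damping_function {μ δ κ : ℝ} (hμ : 0 < μ) (hδ : 0 < δ) (hκ : 0 < κ) :
    ∃ k : ℂ → ℂ, DifferentiableOn ℂ k {a | a.re < 0} ∧ ContinuousAt k 0 ∧ k 0 = 1 ∧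
      (∀ a : ℂ, k a ≠ 0) ∧
      (∀ a : ℂ, a.re < 0 → ‖k a‖ ≤ 1 ∧ ‖k a ^ 2 - ((‖k a‖ ^ 2 : ℝ) : ℂ)‖ ≤ μ) ∧
      ∀ a : ℂ, a.re ≤ -δ → ‖k a‖ ≤ κ := by
  -- The function is `k a = (1 - A a)^(-m)`. The exponent makes `|arg k²| ≤ 2mπ = μ`; `A` is such
  -- that `A δ = κ^(-1/m)`, whence `|k| ≤ (1 + A δ)^(-m) ≤ κ` for `re a ≤ -δ`.
  set m : ℝ := μ / (2 * Real.pi) with hm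
  have hπ := Real.pi_pos
  have hm0 : 0 < m := by positivity
  set A : ℝ := Real.exp (-Real.log κ / m) / δ with hA
  have hA0 : 0 < A := by positivity
  have hre (a : ℂ) : (1 - A * a).re = 1 - A * a.re := by simp
  have hslit (a : ℂ) (ha : a.re ≤ 0) : 1 - A * a ∈ Complex.slitPlane := by
    left
    rw [hre]
    nlinarith
  have hnorm (a : ℂ) : ‖Complex.exp (-m * Complex.log (1 - A * a))‖ =
      Real.exp (-m * Real.log ‖1 - A * a‖) := by
    rw [Complex.norm_exp]
    simp [Complex.log_re]
  have hlog (a : ℂ) (ha : a.re ≤ 0) : Real.log (1 - A * a.re) ≤ Real.log ‖1 - A * a‖ := by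
    apply Real.log_le_log
    · nlinarith
    · rw [← hre]
      exact Complex.re_le_norm _
  refine ⟨fun a => Complex.exp (-m * Complex.log (1 - A * a)), ?_, ?_, by simp,
    fun a => Complex.exp_ne_zero _, ?_, ?_⟩
  · intro a ha
    have := hslit a (le_of_lt ha)
    fun_prop (disch := assumption)
  · have := hslit 0 (by simp)
    fun_prop (disch := assumption)
  · intro a ha
    constructor
    · rw [hnorm]
      apply Real.exp_le_one_iff.2
      have : 0 ≤ Real.log ‖1 - A * a‖ := (Real.log_nonneg (by nlinarith)).trans (hlog a ha.le)
      nlinarith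
    · have hk : ‖Complex.exp (-m * Complex.log (1 - A * a))‖ ≤ 1 := by
        rw [hnorm]
        apply Real.exp_le_one_iff.2
        have : 0 ≤ Real.log ‖1 - A * a‖ := (Real.log_nonneg (by nlinarith)).trans (hlog a ha.le)
        nlinarith
      set θ : ℝ := -2 * m * (1 - A * a).arg with hθ
      have hfac : Complex.exp (-m * Complex.log (1 - A * a)) ^ 2 =
          ((‖Complex.exp (-m * Complex.log (1 - A * a))‖ ^ 2 : ℝ) : ℂ) *
            Complex.exp (Complex.I * θ) := by
        rw [hnorm, Complex.ofReal_pow, Complex.ofReal_exp, ← Complex.exp_nat_mul,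
          ← Complex.exp_nat_mul, ← Complex.exp_add]
        congr 1
        rw [Complex.log, hθ]
        push_cast
        ring
      have h1 : ‖Complex.exp (Complex.I * θ) - 1‖ ≤ ‖θ‖ :=
        Real.norm_exp_I_mul_ofReal_sub_one_le
      have h2 : ‖θ‖ ≤ μ := by
        have := Complex.abs_arg_le_pi (1 - A * a)
        rw [hθ, Real.norm_eq_abs, abs_mul, abs_of_nonpos (by linarith : -2 * m ≤ 0)]
        calc -(-2 * m) * |(1 - A * a).arg| ≤ 2 * m * Real.pi := by nlinarith
          _ = μ := by rw [hm]; field_simp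
      rw [hfac, ← mul_sub_one, norm_mul, Complex.norm_real, Real.norm_of_nonneg (by positivity)]
      calc _ ≤ 1 * μ := by
            gcongr
            · exact pow_le_one₀ (norm_nonneg _) hk
            · exact h1.trans h2
        _ = μ := one_mul μ
  · intro a ha
    rw [hnorm, ← Real.exp_log hκ, Real.exp_le_exp]
    have h1 : -Real.log κ / m ≤ Real.log ‖1 - A * a‖ := by
      refine le_trans ?_ (hlog a (by linarith))
      rw [← Real.log_exp (-Real.log κ / m)]
      apply Real.log_le_log (Real.exp_pos _)
      have : A * δ = Real.exp (-Real.log κ / m) := by rw [hA]; field_simp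
      nlinarith
    rw [div_le_iff₀ hm0] at h1
    linarith

/-! ### Damping, shear and Cayley transform as embeddings -/

section Model

variable {W : Type*} [NormedAddCommGroup W] [NormedSpace ℂ W]

theorem holEmb_damping {k : ℂ → ℂ} (hk : DifferentiableOn ℂ k {a | a.re < 0})
    (hk0 : ∀ a, k a ≠ 0) :
    HolEmb (fun y : ℂ × W => (y.1, k y.1 • y.2)) {y | y.1.re < 0} := by
  have hk' : DifferentiableOn ℂ (fun y : ℂ × W => k y.1) {y | y.1.re < 0} :=
    hk.comp differentiableOn_fst fun y hy => hy
  refine ⟨differentiableOn_fst.prodMk (hk'.smul differentiableOn_snd), fun y => (y.1, (k y.1)⁻¹ • y.2), {y | y.1.re < 0}, ?_, fun y hy => hy, ?_, ?_,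
    ?_⟩
  · exact isOpen_lt (by fun_prop) continuous_const
  · exact differentiableOn_fst.prodMk ((hk'.inv fun y _ => hk0 y.1).smul differentiableOn_snd)
  · rintro ⟨a, w⟩ -
    simp [smul_smul, hk0]
  · rintro ⟨a, w⟩ - -
    simp [smul_smul, hk0]

theorem holEmb_shear {Q : W → ℂ} (hQ : Differentiable ℂ Q) (D : Set (ℂ × W)) :
    HolEmb (fun y : ℂ × W => (y.1 + Q y.2, y.2)) D :=
  ⟨by fun_prop, fun y => (y.1 - Q y.2, y.2), univ, isOpen_univ, mapsTo_univ _ _, by fun_prop,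
    by simp, by simp⟩

/-- The Cayley transform of the domain `re a + ‖w‖² < 0` onto the unit ball, precomposed with the
dilation by `t`. -/
noncomputable def cayley (t : ℝ) (y : ℂ × W) : ℂ × W :=
  ((y.1 + t) / (y.1 - t), ((2 * √t : ℝ) / (y.1 - t) : ℂ) • y.2)

/-- The inverse of `cayley t`. -/
noncomputable def cayleyInv (t : ℝ) (ξ : ℂ × W) : ℂ × W :=
  (t * (ξ.1 + 1) / (ξ.1 - 1), ((√t : ℝ) / (ξ.1 - 1) : ℂ) • ξ.2)

theorem cayley_cayleyInv {t : ℝ} (ht : 0 < t) {ξ : ℂ × W} (hξ : ξ.1 ≠ 1) :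
    cayley t (cayleyInv t ξ) = ξ := by
  have h1 : ξ.1 - 1 ≠ 0 := sub_ne_zero.2 hξ
  have ht' : (t : ℂ) ≠ 0 := by exact_mod_cast ht.ne'
  have hs : (√t : ℂ) * √t = t := by exact_mod_cast Real.mul_self_sqrt ht.le
  have h2 : t * (ξ.1 + 1) / (ξ.1 - 1) - t = 2 * t / (ξ.1 - 1) := by field_simp; ring
  have h3 : t * (ξ.1 + 1) / (ξ.1 - 1) + t = 2 * t * ξ.1 / (ξ.1 - 1) := by field_simp; ring
  ext1
  · simp only [cayley, cayleyInv, h2, h3]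
    field_simp
  · simp only [cayley, cayleyInv, h2, smul_smul]
    convert one_smul ℂ ξ.2
    push_cast
    field_simp
    rw [pow_two, hs]

theorem cayleyInv_cayley {t : ℝ} (ht : 0 < t) {y : ℂ × W} (hy : y.1 ≠ t) :
    cayleyInv t (cayley t y) = y := by
  have h1 : y.1 - t ≠ 0 := sub_ne_zero.2 hy
  have ht' : (t : ℂ) ≠ 0 := by exact_mod_cast ht.ne'
  have hs : (√t : ℂ) * √t = t := by exact_mod_cast Real.mul_self_sqrt ht.le
  have h2 : (y.1 + t) / (y.1 - t) - 1 = 2 * t / (y.1 - t) := by field_simp; ring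
  have h3 : (y.1 + t) / (y.1 - t) + 1 = 2 * y.1 / (y.1 - t) := by field_simp; ring
  ext1
  · simp only [cayley, cayleyInv, h2, h3]
    field_simp
  · simp only [cayley, cayleyInv, h2, smul_smul]
    convert one_smul ℂ y.2
    push_cast
    field_simp
    rw [pow_two, hs]

theorem cayley_fst_ne_one {t : ℝ} (ht : 0 < t) {y : ℂ × W} (hy : y.1 ≠ t) :
    (cayley t y).1 ≠ 1 := by
  have h1 : y.1 - t ≠ 0 := sub_ne_zero.2 hy
  have ht' : (t : ℂ) ≠ 0 := by exact_mod_cast ht.ne'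
  intro h
  rw [cayley, div_eq_one_iff_eq h1] at h
  apply ht'
  linear_combination h / 2

theorem holEmb_cayley {t : ℝ} (ht : 0 < t) :
    HolEmb (cayley t : ℂ × W → ℂ × W) {y | y.1 ≠ t} := by
  refine ⟨?_, cayleyInv t, {ξ | ξ.1 ≠ 1}, ?_, fun y hy => cayley_fst_ne_one ht hy, ?_,
    fun y hy => cayleyInv_cayley ht hy, fun ξ hξ _ => cayley_cayleyInv ht hξ⟩
  · have h (y : ℂ × W) (hy : y ∈ {y : ℂ × W | y.1 ≠ t}) : y.1 - t ≠ 0 := sub_ne_zero.2 hy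
    unfold cayley
    fun_prop (disch := assumption)
  · exact isOpen_ne_fun (by fun_prop) continuous_const
  · have h (y : ℂ × W) (hy : y ∈ {y : ℂ × W | y.1 ≠ 1}) : y.1 - 1 ≠ 0 := sub_ne_zero.2 hy
    unfold cayleyInv
    fun_prop (disch := assumption)

/-- The square of the Euclidean norm on `ℂ × W`. -/
noncomputable def sqNorm (y : ℂ × W) : ℝ := ‖y.1‖ ^ 2 + ‖y.2‖ ^ 2

theorem sqNorm_cayley {t : ℝ} (ht : 0 < t) {y : ℂ × W} (hy : y.1 ≠ t) :
    sqNorm (cayley t y) = 1 + 4 * t * (y.1.re + ‖y.2‖ ^ 2) / ‖y.1 - t‖ ^ 2 := by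
  have h1 : ‖y.1 - t‖ ≠ 0 := norm_ne_zero_iff.2 (sub_ne_zero.2 hy)
  have h2 : ‖y.1 + t‖ ^ 2 = ‖y.1 - t‖ ^ 2 + 4 * t * y.1.re := by
    simp only [Complex.sq_norm, Complex.normSq_apply]
    simp
    ring
  have hs : √t ^ 2 = t := Real.sq_sqrt ht.le
  simp only [sqNorm, cayley, norm_div, norm_smul, Complex.norm_real]
  rw [Real.norm_of_nonneg (by positivity)]
  field_simp
  rw [h2, hs]
  ring

theorem siegel_cayleyInv {t : ℝ} (ht : 0 < t) {ξ : ℂ × W} (hξ : ξ.1 ≠ 1) :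
    (cayleyInv t ξ).1.re + ‖(cayleyInv t ξ).2‖ ^ 2 = t * (sqNorm ξ - 1) / ‖ξ.1 - 1‖ ^ 2 := by
  have h1 : ξ.1 - 1 ≠ 0 := sub_ne_zero.2 hξ
  have h1' : ‖ξ.1 - 1‖ ^ 2 ≠ 0 := by positivity
  have hs : √t ^ 2 = t := Real.sq_sqrt ht.le
  have h2 : (t * (ξ.1 + 1) / (ξ.1 - 1)).re = t * (‖ξ.1‖ ^ 2 - 1) / ‖ξ.1 - 1‖ ^ 2 := by
    rw [Complex.div_re]
    simp only [Complex.sq_norm, Complex.normSq_apply]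
    simp
    ring
  simp only [cayleyInv, sqNorm, norm_div, norm_smul, Complex.norm_real, h2]
  rw [Real.norm_of_nonneg (by positivity)]
  field_simp
  rw [hs]
  ring

end Model

/-! ### Domains close to a quadric -/

section Model

variable {W : Type*} [NormedAddCommGroup W] [NormedSpace ℂ W]

/-- The hypothesis `h` forces `‖w‖² = O(‖a‖)`, so every error is at most `τ ‖a‖`. In turn `‖a‖ ≤ 4
‖Z‖` for the sheared coordinate `Z`, and `t ‖Z‖ ≤ ‖Z - t‖²`; hence the excess of the squared norm
over `1` after `cayley t` is bounded independently of `t`. -/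
theorem siegel_bound_near {Q : W → ℂ} (hQh : ∀ (c : ℂ) w, Q (c • w) = c ^ 2 * Q w)
    (hQn : ∀ w, ‖Q w‖ ≤ ‖w‖ ^ 2) {c ε τ t : ℝ} (hc : 0 < c) (hc1 : c ≤ 1)
    (hqc : ∀ w, c * ‖w‖ ^ 2 ≤ (Q w).re + ‖w‖ ^ 2) (hε : 0 < ε) (hεc : 9 * ε ≤ c * τ)
    (hτ : τ ≤ 1 / 8) (ht : 0 < t) {a k : ℂ} {w : W} (ha : a.re < 0) (hk : ‖k‖ ≤ 1)
    (hk2 : ‖k ^ 2 - ((‖k‖ ^ 2 : ℝ) : ℂ)‖ ≤ ε)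
    (h : a.re + ((Q w).re + ‖w‖ ^ 2) ≤ ε * (‖w‖ ^ 2 + ‖a‖)) :
    a + Q (k • w) ≠ t ∧
      4 * t * ((a + Q (k • w)).re + ‖k • w‖ ^ 2) ≤ 16 * τ * ‖a + Q (k • w) - t‖ ^ 2 := by
  have hapos : 0 < ‖a‖ := norm_pos_iff.2 fun h => by simp [h] at ha
  have hτ0 : 0 < τ := by
    by_contra! hcon
    nlinarith
  have hare := Complex.abs_re_le_norm a
  rw [abs_of_neg ha] at hare
  have hw : c * ‖w‖ ^ 2 ≤ 4 * ‖a‖ := by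
    have := hqc w
    have h1 : ε * ‖w‖ ^ 2 ≤ c / 2 * ‖w‖ ^ 2 := by gcongr; nlinarith
    have h2 : ε * ‖a‖ ≤ 1 * ‖a‖ := by gcongr; nlinarith
    linarith
  have hkw : ‖k • w‖ ^ 2 = ‖k‖ ^ 2 * ‖w‖ ^ 2 := by rw [norm_smul, mul_pow]
  have hk2' : ‖k‖ ^ 2 ≤ 1 := pow_le_one₀ (norm_nonneg _) hk
  have hQk : (Q (k • w)).re ≤ ‖k‖ ^ 2 * (Q w).re + ε * ‖w‖ ^ 2 := by
    -- Replacing `k²` by `‖k‖²` lets `re Q` and `‖·‖²` scale by the same factor.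
    have e : Q (k • w) = ((‖k‖ ^ 2 : ℝ) : ℂ) * Q w + (k ^ 2 - ((‖k‖ ^ 2 : ℝ) : ℂ)) * Q w := by
      rw [hQh]; ring
    rw [e, Complex.add_re, Complex.re_ofReal_mul]
    gcongr
    refine (Complex.re_le_norm _).trans ?_
    rw [norm_mul]
    exact mul_le_mul hk2 (hQn w) (norm_nonneg _) hε.le
  set Z := a + Q (k • w) with hZ
  have hZre : Z.re = a.re + (Q (k • w)).re := by simp [hZ]
  have hN : Z.re + ‖k • w‖ ^ 2 ≤ τ * ‖a‖ := by
    have hq : 0 ≤ (Q w).re + ‖w‖ ^ 2 := le_trans (by positivity) (hqc w)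
    have h1 : ‖k‖ ^ 2 * ((Q w).re + ‖w‖ ^ 2) ≤ (Q w).re + ‖w‖ ^ 2 :=
      mul_le_of_le_one_left hq hk2'
    have h2 : Z.re + ‖k • w‖ ^ 2 ≤ ε * (2 * ‖w‖ ^ 2 + ‖a‖) := by
      rw [hZre, hkw]; linarith
    refine h2.trans ?_
    have h3 : c * (ε * (2 * ‖w‖ ^ 2 + ‖a‖)) ≤ c * (τ * ‖a‖) := by
      calc c * (ε * (2 * ‖w‖ ^ 2 + ‖a‖)) = ε * (2 * (c * ‖w‖ ^ 2) + c * ‖a‖) := by ring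
        _ ≤ ε * (2 * (4 * ‖a‖) + 1 * ‖a‖) := by gcongr
        _ = 9 * ε * ‖a‖ := by ring
        _ ≤ c * τ * ‖a‖ := by gcongr
        _ = _ := by ring
    exact le_of_mul_le_mul_left h3 hc
  -- The shear changes `a` by at most `‖k • w‖²`, which `hN` bounds by `τ ‖a‖ - re Z`.
  have hZa : ‖a‖ ≤ 4 * ‖Z‖ := by
    have h1 : ‖a‖ - ‖k • w‖ ^ 2 ≤ ‖Z‖ := by
      have h2 : a = Z - Q (k • w) := by rw [hZ]; ring
      have h3 := norm_sub_le Z (Q (k • w))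
      rw [← h2] at h3
      linarith [hQn (k • w)]
    have h2 : -Z.re ≤ ‖Z‖ := (neg_le_abs _).trans (Complex.abs_re_le_norm Z)
    have h3 : τ * ‖a‖ ≤ 1 / 8 * ‖a‖ := by gcongr
    linarith
  have hZpos : 0 < ‖Z‖ := by linarith
  have hZre2 : Z.re ≤ 4 * τ * ‖Z‖ := by
    have : τ * ‖a‖ ≤ τ * (4 * ‖Z‖) := by gcongr
    nlinarith [sq_nonneg ‖k • w‖]
  have hexp : ‖Z - t‖ ^ 2 = ‖Z‖ ^ 2 + t ^ 2 - 2 * t * Z.re := by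
    simp only [Complex.sq_norm, Complex.normSq_apply]
    simp
    ring
  have hlow : t * ‖Z‖ ≤ ‖Z - t‖ ^ 2 := by
    have h1 : 2 * t * Z.re ≤ 2 * t * (1 / 2 * ‖Z‖) := by
      gcongr
      refine hZre2.trans ?_
      gcongr
      linarith
    rw [hexp]
    nlinarith [sq_nonneg (‖Z‖ - t)]
  constructor
  · intro h0
    rw [h0, sub_self, norm_zero] at hlow
    rw [h0] at hZpos
    nlinarith
  · calc 4 * t * (Z.re + ‖k • w‖ ^ 2) ≤ 4 * t * (τ * (4 * ‖Z‖)) := by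
          gcongr
          exact hN.trans (by gcongr)
      _ = 16 * τ * (t * ‖Z‖) := by ring
      _ ≤ 16 * τ * ‖Z - t‖ ^ 2 := by gcongr

/-- Both `re Q` and the squared norm of the damped vector are at most `(κ R)²`, so they cannot
compensate `re a ≤ -δ`. -/
theorem siegel_bound_far {Q : W → ℂ} (hQn : ∀ w, ‖Q w‖ ≤ ‖w‖ ^ 2) {δ R κ : ℝ}
    (hκR : 2 * (κ * R) ^ 2 < δ) {a k : ℂ} {w : W} (ha : a.re ≤ -δ) (hk : ‖k‖ ≤ κ)
    (hw : ‖w‖ ≤ R) : (a + Q (k • w)).re + ‖k • w‖ ^ 2 < 0 := by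
  have h1 : ‖k • w‖ ≤ κ * R := by
    rw [norm_smul]
    exact mul_le_mul hk hw (norm_nonneg _) ((norm_nonneg _).trans hk)
  have h2 : ‖k • w‖ ^ 2 ≤ (κ * R) ^ 2 := pow_le_pow_left₀ (norm_nonneg _) h1 2
  have h3 := (Complex.re_le_norm _).trans (hQn (k • w))
  rw [Complex.add_re]
  linarith

/-- The preimage of the smaller ball lives at the anisotropic scale `(t, √t)` and has depth
comparable to `t` in the Siegel domain, so errors `ε · O(t)` are harmless for small `ε`. -/
theorem cayleyInv_bounds {η : ℝ} (hη : 0 < η) (hη1 : η ≤ 1) {t : ℝ} (ht : 0 < t) {ξ : ℂ × W}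
    (hξ : sqNorm ξ < (1 - η) ^ 2) :
    ξ.1 ≠ 1 ∧ ‖(cayleyInv t ξ).1‖ ≤ t * (2 / η) ∧ ‖(cayleyInv t ξ).2‖ ^ 2 ≤ t * (2 / η) ^ 2 ∧
      (cayleyInv t ξ).1.re + ‖(cayleyInv t ξ).2‖ ^ 2 ≤ -(t * η / 4) := by
  have hs : √t ^ 2 = t := Real.sq_sqrt ht.le
  have hx1 : ‖ξ.1‖ ≤ 1 - η := by
    refine (abs_le_of_sq_le_sq' ?_ (by linarith)).2
    unfold sqNorm at hξ
    linarith [sq_nonneg ‖ξ.2‖]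
  have hx2 : ‖ξ.2‖ ≤ 1 - η := by
    refine (abs_le_of_sq_le_sq' ?_ (by linarith)).2
    unfold sqNorm at hξ
    linarith [sq_nonneg ‖ξ.1‖]
  have hd1 : η ≤ ‖ξ.1 - 1‖ := by
    have := norm_sub_norm_le (1 : ℂ) ξ.1
    rw [norm_sub_rev, norm_one] at this
    linarith
  have hd2 : ‖ξ.1 - 1‖ ≤ 2 := by
    have := norm_sub_le ξ.1 1
    rw [norm_one] at this
    linarith
  have hdpos : 0 < ‖ξ.1 - 1‖ := hη.trans_le hd1
  have hξ1 : ξ.1 ≠ 1 := sub_ne_zero.1 (norm_pos_iff.1 hdpos)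
  refine ⟨hξ1, ?_, ?_, ?_⟩
  · simp only [cayleyInv, norm_div, norm_mul, Complex.norm_real, Real.norm_of_nonneg ht.le]
    rw [mul_div_assoc]
    gcongr
    have := norm_add_le ξ.1 1
    rw [norm_one] at this
    linarith
  · have hu : ‖(cayleyInv t ξ).2‖ ≤ √t * (2 / η) := by
      simp only [cayleyInv, norm_smul, norm_div, Complex.norm_real,
        Real.norm_of_nonneg (Real.sqrt_nonneg t)]
      rw [div_mul_eq_mul_div, mul_div_assoc]
      gcongr
      linarith
    calc _ ≤ (√t * (2 / η)) ^ 2 := by gcongr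
      _ = t * (2 / η) ^ 2 := by rw [mul_pow, hs]
  · rw [siegel_cayleyInv ht hξ1, div_le_iff₀ (by positivity)]
    have h1 : ‖ξ.1 - 1‖ ^ 2 ≤ 2 ^ 2 := by gcongr
    have h2 : sqNorm ξ - 1 ≤ -η := by nlinarith
    have h3 : t * (sqNorm ξ - 1) ≤ t * -η := by gcongr
    have h4 : t * η / 4 * ‖ξ.1 - 1‖ ^ 2 ≤ t * η / 4 * 2 ^ 2 := by gcongr
    linarith

/-- The preimage of a point of a slightly smaller ball lies well inside the domain. -/
theorem siegel_preimage {Q : W → ℂ} (hQh : ∀ (c : ℂ) w, Q (c • w) = c ^ 2 * Q w)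
    (hQn : ∀ w, ‖Q w‖ ≤ ‖w‖ ^ 2) {η ε : ℝ} (hη : 0 < η) (hη1 : η ≤ 1) (hε : 0 < ε)
    (hεη : ε ≤ η ^ 3 / 256) {k : ℂ → ℂ} (hk0 : ∀ a, k a ≠ 0) (hk : ContinuousAt k 0)
    (hk1 : k 0 = 1) {r : ℝ} (hr : 0 < r) :
    ∃ s > (0 : ℝ), ∀ t : ℝ, 0 < t → t < s → ∀ ξ : ℂ × W, sqNorm ξ < (1 - η) ^ 2 →
      ∃ y : ℂ × W, y.1.re < 0 ∧ ‖y‖ < r ∧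
        y.1.re + ((Q y.2).re + ‖y.2‖ ^ 2) < -(ε * (‖y.2‖ ^ 2 + ‖y.1‖)) ∧
        (y.1 + Q (k y.1 • y.2), k y.1 • y.2) = cayleyInv t ξ ∧ ξ.1 ≠ 1 := by
  -- Undoing the damping divides `w` by `k`, hence multiplies `Q` by `k⁻²`, which is close to `1`
  -- once `t` is small.
  have hkk : ContinuousAt (fun a => (k a)⁻¹ ^ 2) 0 := (hk.inv₀ (hk0 0)).pow 2
  obtain ⟨d, hd, hkd⟩ := Metric.continuousAt_iff.1 hkk ε hε
  obtain ⟨M, hM⟩ : ∃ M : ℝ, M = 2 / η := ⟨_, rfl⟩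
  have hM0 : 0 < M := by rw [hM]; positivity
  have hM1 : 1 ≤ M := by rw [hM, le_div_iff₀ hη]; linarith
  have hMη : η ^ 3 / 256 * M ^ 2 = η / 64 := by rw [hM]; field_simp; norm_num
  have hη3 : η ^ 3 ≤ 1 := pow_le_one₀ hη.le hη1
  refine ⟨min (d / (2 * M ^ 2)) (min (r / (2 * M ^ 2)) (r ^ 2 / (4 * M ^ 2))), by positivity, ?_⟩
  intro t ht hts ξ hξ
  have ht1 : t * (2 * M ^ 2) < d := (lt_div_iff₀ (by positivity)).1 (hts.trans_le (min_le_left _ _))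
  have ht2 : t * (2 * M ^ 2) < r := (lt_div_iff₀ (by positivity)).1
    (hts.trans_le ((min_le_right _ _).trans (min_le_left _ _)))
  have ht3 : t * (4 * M ^ 2) < r ^ 2 := (lt_div_iff₀ (by positivity)).1
    (hts.trans_le ((min_le_right _ _).trans (min_le_right _ _)))
  obtain ⟨hξ1, hb, hu2, hneg⟩ := cayleyInv_bounds hη hη1 ht hξ
  rw [← hM] at hb hu2
  generalize cayleyInv t ξ = p at hb hu2 hneg ⊢
  obtain ⟨b, u⟩ := p
  simp only at hb hu2 hneg
  have hQu := hQn u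
  have htη : 0 < t * η := by positivity
  have haM : ‖b - Q u‖ ≤ t * (2 * M ^ 2) := by
    have := norm_sub_le b (Q u)
    have : t * M ≤ t * M ^ 2 := by gcongr; exact le_self_pow₀ hM1 two_ne_zero
    linarith
  have hare : (b - Q u).re < 0 := by
    have := (neg_le_abs _).trans (Complex.abs_re_le_norm (Q u))
    rw [Complex.sub_re]
    linarith
  have hkν : ‖(k (b - Q u))⁻¹ ^ 2 - 1‖ < ε := by
    have := hkd (x := b - Q u) (by rw [dist_zero_right]; linarith)
    rwa [dist_eq_norm, hk1, inv_one, one_pow] at this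
  have hkl : k (b - Q u) • (k (b - Q u))⁻¹ • u = u := by
    rw [smul_smul, mul_inv_cancel₀ (hk0 _), one_smul]
  generalize hl : (k (b - Q u))⁻¹ = l at hkν hkl
  have hl2 : ‖l‖ ^ 2 ≤ 1 + ε := by
    rw [← norm_pow]
    have := norm_le_norm_add_norm_sub' (l ^ 2) 1
    rw [norm_one] at this
    linarith
  have hlu : ‖l • u‖ ^ 2 ≤ ‖u‖ ^ 2 + ε * ‖u‖ ^ 2 := by
    calc ‖l • u‖ ^ 2 = ‖l‖ ^ 2 * ‖u‖ ^ 2 := by rw [norm_smul, mul_pow]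
      _ ≤ (1 + ε) * ‖u‖ ^ 2 := by gcongr
      _ = _ := by ring
  have hεu : ε * ‖u‖ ^ 2 ≤ ε * (t * M ^ 2) := by gcongr
  have hlu2 : ‖l • u‖ ^ 2 ≤ 2 * (t * M ^ 2) := by
    have : ε * (t * M ^ 2) ≤ 1 * (t * M ^ 2) := by gcongr; linarith
    linarith
  refine ⟨(b - Q u, l • u), hare, ?_, ?_, ?_, hξ1⟩
  · rw [Prod.norm_def]
    apply max_lt
    · exact haM.trans_lt ht2
    · refine lt_of_pow_lt_pow_left₀ 2 hr.le ?_
      change ‖l • u‖ ^ 2 < _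
      have : 0 < t * M ^ 2 := by positivity
      linarith
  · have h1 : (Q (l • u)).re ≤ (Q u).re + ε * ‖u‖ ^ 2 := by
      have e : Q (l • u) = Q u + (l ^ 2 - 1) * Q u := by rw [hQh]; ring
      rw [e, Complex.add_re]
      gcongr
      refine (Complex.re_le_norm _).trans ?_
      rw [norm_mul]
      exact mul_le_mul hkν.le hQu (norm_nonneg _) hε.le
    have h4 : ε * (‖l • u‖ ^ 2 + ‖b - Q u‖) ≤ ε * (2 * (t * M ^ 2) + t * (2 * M ^ 2)) := by gcongr
    -- All errors together amount to at most six such terms, that is `6tη/64`, less than the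
    -- available depth `tη/4`.
    have h5 : ε * (t * M ^ 2) ≤ t * η / 64 := by
      calc ε * (t * M ^ 2) ≤ η ^ 3 / 256 * (t * M ^ 2) := by gcongr
        _ = t * (η ^ 3 / 256 * M ^ 2) := by ring
        _ = t * η / 64 := by rw [hMη]; ring
    simp only [Complex.sub_re]
    linarith
  · simp only [hkl, sub_add_cancel]

/-- A domain of `ℂ × W` that is squeezed between small perturbations of the quadric domain
`re a + re (Q w) + ‖w‖² < 0`, at least close to the origin, embeds into a ball of radius `1 + η`
with an image containing the ball of radius `1 - η`. -/
theorem exists_holEmb_of_near_quadric {Q : W → ℂ} (hQd : Differentiable ℂ Q)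
    (hQh : ∀ (c : ℂ) w, Q (c • w) = c ^ 2 * Q w)
    (hQn : ∀ w, ‖Q w‖ ≤ ‖w‖ ^ 2) {c : ℝ} (hc : 0 < c)
    (hqc : ∀ w, c * ‖w‖ ^ 2 ≤ (Q w).re + ‖w‖ ^ 2) {η : ℝ} (hη : 0 < η) (hη1 : η ≤ 1) :
    ∃ ε > (0 : ℝ), ∀ r > (0 : ℝ), ∀ δ > (0 : ℝ), ∀ R : ℝ, ∃ s > (0 : ℝ), ∀ Ω : Set (ℂ × W),
      (∀ y ∈ Ω, y.1.re < 0) →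
      (∀ y ∈ Ω, y.1.re + ((Q y.2).re + ‖y.2‖ ^ 2) ≤ ε * (‖y.2‖ ^ 2 + ‖y.1‖) ∨
        (y.1.re ≤ -δ ∧ ‖y.2‖ ≤ R)) →
      (∀ y : ℂ × W, ‖y‖ < r →
        y.1.re + ((Q y.2).re + ‖y.2‖ ^ 2) < -(ε * (‖y.2‖ ^ 2 + ‖y.1‖)) → y ∈ Ω) →
      ∀ t : ℝ, 0 < t → t < s → ∃ G : ℂ × W → ℂ × W, HolEmb G Ω ∧
        (∀ y ∈ Ω, sqNorm (G y) < (1 + η) ^ 2) ∧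
        (∀ ξ, sqNorm ξ < (1 - η) ^ 2 → ξ ∈ G '' Ω) ∧
        ∀ a, G (a, 0) = ((a + t) / (a - t), 0) := by
  obtain ⟨c, hc, hc1, hqc⟩ : ∃ c : ℝ, 0 < c ∧ c ≤ 1 ∧
      ∀ w, c * ‖w‖ ^ 2 ≤ (Q w).re + ‖w‖ ^ 2 :=
    ⟨min c 1, by positivity, min_le_right _ _, fun w => le_trans (by gcongr; exact min_le_left _ _)
      (hqc w)⟩
  have hQ0 : Q 0 = 0 := by simpa using hQh 0 0
  -- The first bound serves the inclusion in the large ball (with `τ = η / 8`), the second serves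
  -- the covering of the small ball. Neither depends on `r`, `δ`, `R`, which the application obtains
  -- only after `ε`.
  set ε : ℝ := min (c * (η / 8) / 9) (η ^ 3 / 256) with hε_def
  have hε : 0 < ε := by positivity
  have hε1 : 9 * ε ≤ c * (η / 8) := by
    have := min_le_left (c * (η / 8) / 9) (η ^ 3 / 256)
    linarith
  refine ⟨ε, hε, fun r hr δ hδ R => ?_⟩
  obtain ⟨κ, hκ, hκR⟩ : ∃ κ : ℝ, 0 < κ ∧ 2 * (κ * R) ^ 2 < δ := by
    refine ⟨√(δ / (4 * (R ^ 2 + 1))), by positivity, ?_⟩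
    rw [mul_pow, Real.sq_sqrt (by positivity), div_mul_eq_mul_div, ← mul_div_assoc,
      div_lt_iff₀ (by positivity)]
    nlinarith [sq_nonneg R]
  obtain ⟨k, hkd, hkc, hk1, hk0, hkn, hkf⟩ := exists_damping_function hε hδ hκ
  obtain ⟨s, hs, hpre⟩ := siegel_preimage (W := W) hQh hQn hη hη1 hε (min_le_right _ _) hk0 hkc hk1 hr
  refine ⟨s, hs, fun Ω hΩre hΩ1 hΩ2 t ht hts => ?_⟩
  have key (y) (hy : y ∈ Ω) : y.1 + Q (k y.1 • y.2) ≠ t ∧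
      4 * t * ((y.1 + Q (k y.1 • y.2)).re + ‖k y.1 • y.2‖ ^ 2) ≤
        2 * η * ‖y.1 + Q (k y.1 • y.2) - t‖ ^ 2 := by
    rcases hΩ1 y hy with h | h
    · have := siegel_bound_near hQh hQn hc hc1 hqc hε hε1 (by linarith) ht (hΩre y hy)
        (hkn y.1 (hΩre y hy)).1 (hkn y.1 (hΩre y hy)).2 h
      rwa [show 16 * (η / 8) = 2 * η by ring] at this
    · have hneg := siegel_bound_far hQn hκR h.1 (hkf _ h.1) h.2
      constructor
      · intro h0
        rw [h0, Complex.ofReal_re] at hneg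
        nlinarith [sq_nonneg ‖k y.1 • y.2‖]
      · refine le_trans ?_ (by positivity : 0 ≤ 2 * η * ‖y.1 + Q (k y.1 • y.2) - t‖ ^ 2)
        nlinarith
  refine ⟨fun y => cayley t (y.1 + Q (k y.1 • y.2), k y.1 • y.2), ?_, ?_, ?_, ?_⟩
  · have h1 : HolEmb (fun y : ℂ × W => (y.1 + Q (k y.1 • y.2), k y.1 • y.2)) Ω :=
      (holEmb_shear hQd univ).comp ((holEmb_damping hkd hk0).mono hΩre) (mapsTo_univ _ _)
        isOpen_univ
    exact (holEmb_cayley ht).comp h1 (fun y hy => (key y hy).1)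
      (isOpen_ne_fun (by fun_prop) continuous_const)
  · intro y hy
    obtain ⟨h1, h2⟩ := key y hy
    have h3 : 0 < ‖y.1 + Q (k y.1 • y.2) - t‖ := norm_pos_iff.2 (sub_ne_zero.2 h1)
    rw [sqNorm_cayley ht h1]
    have : 4 * t * ((y.1 + Q (k y.1 • y.2)).re + ‖k y.1 • y.2‖ ^ 2) /
        ‖y.1 + Q (k y.1 • y.2) - t‖ ^ 2 ≤ 2 * η := (div_le_iff₀ (by positivity)).2 h2
    nlinarith
  · intro ξ hξ
    obtain ⟨y, hy0, hyr, hy1, hy2, hξ1⟩ := hpre t ht hts ξ hξ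
    refine ⟨y, hΩ2 y hyr hy1, ?_⟩
    simp only [hy2]
    exact cayley_cayleyInv ht hξ1
  · intro a
    simp [cayley, hQ0]

end Model

/-! ### Levi form and coordinates adapted to the Hessian -/

section Levi

variable {K : Type*} [AddCommGroup K] [Module ℂ K]

theorem Complex.smul_eq_re_smul_add (r : ℂ) (v : K) :
    r • v = r.re • v + r.im • (Complex.I • v) := by
  conv_lhs => rw [← Complex.re_add_im r]
  rw [add_smul, mul_smul, Complex.coe_smul, Complex.coe_smul]

theorem Complex.I_smul_smul_eq (r : ℂ) (v : K) :
    Complex.I • r • v = r.re • (Complex.I • v) - r.im • v := by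
  rw [smul_smul, Complex.smul_eq_re_smul_add, Complex.I_mul_re, Complex.I_mul_im]
  module

/-- A positive definite real symmetric bilinear form on a complex vector space has a Hermitian part
that is the square of a Euclidean norm in suitable complex coordinates. -/
theorem exists_linearEquiv_norm_sq_eq [FiniteDimensional ℂ K] (H : K →ₗ[ℝ] K →ₗ[ℝ] ℝ)
    (hs : ∀ v w, H v w = H w v) (hp : ∀ v, v ≠ 0 → 0 < H v v) :
    ∃ φ : K ≃ₗ[ℂ] EuclideanSpace ℂ (Fin (Module.finrank ℂ K)),
      ∀ v, ‖φ v‖ ^ 2 = (H v v + H (Complex.I • v) (Complex.I • v)) / 4 := by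
  -- This is the Hermitian form whose real part is the `I`-invariant part of `H`; it is positive
  -- because `H` is positive at both `v` and `I • v`.
  let c : InnerProductSpace.Core ℂ K :=
    { inner := fun v w => ⟨(H v w + H (Complex.I • v) (Complex.I • w)) / 4,
        (H (Complex.I • v) w - H v (Complex.I • w)) / 4⟩
      conj_inner_symm := fun v w => by
        apply Complex.ext
        · simp [hs w v, hs (Complex.I • w)]
        · simp [hs (Complex.I • w), hs w (Complex.I • v)]
          ring
      re_inner_nonneg := fun v => by
        have h (v : K) : 0 ≤ H v v := by
          rcases eq_or_ne v 0 with rfl | hv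
          · simp
          · exact (hp v hv).le
        have h1 := h v
        have h2 := h (Complex.I • v)
        simp only [RCLike.re_to_complex]
        positivity
      add_left := fun u v w => by
        apply Complex.ext <;> simp <;> ring
      smul_left := fun v w r => by
        apply Complex.ext
        · simp only [Complex.I_smul_smul_eq, Complex.mul_re, Complex.conj_re, Complex.conj_im]
          simp only [Complex.smul_eq_re_smul_add r, map_add, map_sub, map_smul,
            LinearMap.add_apply, LinearMap.sub_apply, LinearMap.smul_apply, smul_eq_mul]
          ring
        · simp only [Complex.I_smul_smul_eq, Complex.mul_im, Complex.conj_re, Complex.conj_im]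
          simp only [Complex.smul_eq_re_smul_add r, map_add, map_sub, map_smul,
            LinearMap.add_apply, LinearMap.sub_apply, LinearMap.smul_apply, smul_eq_mul]
          ring
      definite := fun v hv => by
        by_contra hv0
        have h1 := hp v hv0
        have h2 := hp (Complex.I • v) (smul_ne_zero Complex.I_ne_zero hv0)
        have h3 := congrArg Complex.re hv
        simp only [Complex.zero_re] at h3
        linarith }
  let := @InnerProductSpace.Core.toNormedAddCommGroup ℂ K _ _ _ c
  let : InnerProductSpace ℂ K := InnerProductSpace.ofCore c.toCore
  refine ⟨(stdOrthonormalBasis ℂ K).repr.toLinearEquiv, fun v => ?_⟩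
  rw [LinearIsometryEquiv.coe_toLinearEquiv, LinearIsometryEquiv.norm_map,
    ← inner_self_eq_norm_sq (𝕜 := ℂ)]
  rfl

/-- The `(2, 0)`-part of a real symmetric bilinear form on a complex vector space. -/
theorem exists_bilin_re_eq (H : K →ₗ[ℝ] K →ₗ[ℝ] ℝ) :
    ∃ B : K →ₗ[ℂ] K →ₗ[ℂ] ℂ,
      ∀ v, (B v v).re = (H v v - H (Complex.I • v) (Complex.I • v)) / 4 := by
  refine ⟨LinearMap.mk₂ ℂ (fun v w => ⟨(H v w - H (Complex.I • v) (Complex.I • w)) / 4,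
    -(H (Complex.I • v) w + H v (Complex.I • w)) / 4⟩) ?_ ?_ ?_ ?_, fun v => rfl⟩
  · intro u v w
    apply Complex.ext <;> simp <;> ring
  · intro r v w
    apply Complex.ext
    · simp only [Complex.I_smul_smul_eq, smul_eq_mul, Complex.mul_re]
      simp only [Complex.smul_eq_re_smul_add r, map_add, map_sub, map_smul, LinearMap.add_apply,
        LinearMap.sub_apply, LinearMap.smul_apply, smul_eq_mul]
      ring
    · simp only [Complex.I_smul_smul_eq, smul_eq_mul, Complex.mul_im]
      simp only [Complex.smul_eq_re_smul_add r, map_add, map_sub, map_smul, LinearMap.add_apply,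
        LinearMap.sub_apply, LinearMap.smul_apply, smul_eq_mul]
      ring
  · intro u v w
    apply Complex.ext <;> simp <;> ring
  · intro r v w
    apply Complex.ext
    · simp only [Complex.I_smul_smul_eq, smul_eq_mul, Complex.mul_re]
      simp only [Complex.smul_eq_re_smul_add r, map_add, map_sub, map_smul, smul_eq_mul]
      ring
    · simp only [Complex.I_smul_smul_eq, smul_eq_mul, Complex.mul_im]
      simp only [Complex.smul_eq_re_smul_add r, map_add, map_sub, map_smul, smul_eq_mul]
      ring

end Levi

/-- The constant is the minimum of `q` on the compact unit sphere, carried over by homogeneity. -/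
theorem exists_pos_mul_sq_le {V : Type*} [NormedAddCommGroup V] [NormedSpace ℝ V]
    [FiniteDimensional ℝ V] {q : V → ℝ} (hq : Continuous q)
    (hh : ∀ (r : ℝ) v, q (r • v) = r ^ 2 * q v) (hp : ∀ v, v ≠ 0 → 0 < q v) :
    ∃ c : ℝ, 0 < c ∧ ∀ v, c * ‖v‖ ^ 2 ≤ q v := by
  have h0 : q 0 = 0 := by simpa using hh 0 0
  have hmem (v : V) (hv : v ≠ 0) : ‖v‖⁻¹ • v ∈ Metric.sphere (0 : V) 1 := by
    simp [norm_smul, hv]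
  rcases (Metric.sphere (0 : V) 1).eq_empty_or_nonempty with h | h
  · refine ⟨1, one_pos, fun v => ?_⟩
    rcases eq_or_ne v 0 with rfl | hv
    · simp [h0]
    · exact absurd (hmem v hv) (by simp [h])
  · obtain ⟨u, hu, hmin⟩ := (isCompact_sphere _ _).exists_isMinOn h hq.continuousOn
    refine ⟨q u, hp u (ne_zero_of_mem_unit_sphere ⟨u, hu⟩), fun v => ?_⟩
    rcases eq_or_ne v 0 with rfl | hv
    · simp [h0]
    · have h2 : q u ≤ q (‖v‖⁻¹ • v) := hmin (hmem v hv)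
      rw [hh, inv_pow, inv_mul_eq_div, le_div_iff₀ (by positivity)] at h2
      exact h2

/-- A real symmetric bilinear form that is positive definite on the real hyperplane `re ℓ = 0`
restricts, on the complex hyperplane `ℓ = 0`, to `re Q + ‖·‖²` in suitable coordinates. -/
theorem exists_adapted_coordinates {E : Type*} [NormedAddCommGroup E] [NormedSpace ℂ E]
    [FiniteDimensional ℂ E] {l : E →L[ℝ] ℝ} (hl : l ≠ 0) {H : E →L[ℝ] E →L[ℝ] ℝ}
    (hs : ∀ v w, H v w = H w v) (hp : ∀ v, v ≠ 0 → l v = 0 → 0 < H v v) :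
    ∃ (m : ℕ) (T : E ≃L[ℂ] ℂ × EuclideanSpace ℂ (Fin m)) (Q : EuclideanSpace ℂ (Fin m) → ℂ) (c : ℝ),
      Module.finrank ℂ E = m + 1 ∧ (∀ v, (T v).1.re = l v) ∧ Differentiable ℂ Q ∧
      (∀ (r : ℂ) w, Q (r • w) = r ^ 2 * Q w) ∧ (∀ w, ‖Q w‖ ≤ ‖w‖ ^ 2) ∧ 0 < c ∧
      (∀ w, c * ‖w‖ ^ 2 ≤ (Q w).re + ‖w‖ ^ 2) ∧
      ∀ w, H (T.symm (0, w)) (T.symm (0, w)) = 2 * ((Q w).re + ‖w‖ ^ 2) := by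
  obtain ⟨L, hL⟩ : ∃ L : E →ₗ[ℂ] ℂ, ∀ v, (L v).re = l v :=
    ⟨Module.Dual.extendRCLike l.toLinearMap, fun v => Module.Dual.re_extendRCLike_apply (𝕜 := ℂ) l.toLinearMap v⟩
  have hL0 : L ≠ 0 := by
    rintro rfl
    exact hl (by ext v; simp [← hL])
  -- A vector with `L e = 1` splits the space as `ℂ e ⊕ ker L`; the Levi form then normalises the
  -- coordinates on `ker L`.
  obtain ⟨e, he⟩ := LinearMap.surjective hL0 1
  let K := LinearMap.ker L
  let HK : K →ₗ[ℝ] K →ₗ[ℝ] ℝ := LinearMap.mk₂ ℝ (fun v w => H v w) (by simp) (by simp) (by simp)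
    (by simp)
  have hK (v : K) : l v = 0 := by rw [← hL, v.2, Complex.zero_re]
  have hHp (v : K) (hv : v ≠ 0) : 0 < HK v v := hp v (by simpa using hv) (hK v)
  obtain ⟨φ, hφ⟩ := exists_linearEquiv_norm_sq_eq HK (fun v w => hs v w) hHp
  obtain ⟨B, hB⟩ := exists_bilin_re_eq HK
  have hproj (v : E) : v - L v • e ∈ K := by simp [K, he]
  let T₀ : E ≃ₗ[ℂ] ℂ × EuclideanSpace ℂ (Fin (Module.finrank ℂ K)) :=
    { toFun := fun v => (L v, φ ⟨v - L v • e, hproj v⟩)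
      map_add' := fun v w => by
        ext1
        · simp
        · simp only [Prod.snd_add, ← map_add]
          congr 1
          ext1
          simp only [map_add, Submodule.coe_add]
          module
      map_smul' := fun r v => by
        ext1
        · simp
        · simp only [Prod.smul_snd, ← map_smul, RingHom.id_apply]
          congr 1
          ext1
          simp only [map_smul, Submodule.coe_smul, smul_eq_mul]
          module
      invFun := fun y => y.1 • e + φ.symm y.2
      left_inv := fun v => by simp
      right_inv := fun y => by
        have h : L (φ.symm y.2 : E) = 0 := (φ.symm y.2).2
        ext1
        · simp [he, h]
        · simp [he, h] }
  have hT₀ (w) : T₀.symm (0, w) = φ.symm w := by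
    change (0 : ℂ) • e + _ = _
    simp
  have hre (w) : (B (φ.symm w) (φ.symm w)).re + ‖w‖ ^ 2 = HK (φ.symm w) (φ.symm w) / 2 := by
    have := hφ (φ.symm w)
    rw [LinearEquiv.apply_symm_apply] at this
    rw [this, hB]
    ring
  have hQd : Differentiable ℂ fun w => B (φ.symm w) (φ.symm w) := by
    let B' := LinearMap.toContinuousLinearMap (LinearMap.toContinuousLinearMap.toLinearMap ∘ₗ
      B.compl₁₂ φ.symm.toLinearMap φ.symm.toLinearMap)
    have : Differentiable ℂ fun w => B' w w := by fun_prop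
    exact this
  have hQh (r : ℂ) (w) : B (φ.symm (r • w)) (φ.symm (r • w)) = r ^ 2 * B (φ.symm w) (φ.symm w) := by
    simp only [map_smul, LinearMap.smul_apply, smul_eq_mul]
    ring
  generalize hQ_def : (fun w => B (φ.symm w) (φ.symm w)) = Q at hQd
  replace hre (w) : (Q w).re + ‖w‖ ^ 2 = HK (φ.symm w) (φ.symm w) / 2 := by
    rw [← hre, ← hQ_def]
  replace hQh (r : ℂ) (w) : Q (r • w) = r ^ 2 * Q w := by
    rw [← hQ_def]; exact hQh r w
  have hpos (w) (hw : w ≠ 0) : 0 < (Q w).re + ‖w‖ ^ 2 := by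
    rw [hre]
    exact half_pos (hHp _ (by simpa using hw))
  obtain ⟨c, hc, hqc⟩ : ∃ c : ℝ, 0 < c ∧ ∀ w, c * ‖w‖ ^ 2 ≤ (Q w).re + ‖w‖ ^ 2 := by
    have hcont : Continuous fun w => (Q w).re + ‖w‖ ^ 2 :=
      (Complex.continuous_re.comp hQd.continuous).add (by fun_prop)
    refine exists_pos_mul_sq_le hcont (fun r w => ?_) hpos
    rw [← Complex.coe_smul, hQh, norm_smul, Complex.norm_real, Real.norm_eq_abs, mul_pow, sq_abs,
      ← Complex.ofReal_pow, Complex.re_ofReal_mul]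
    ring
  refine ⟨_, T₀.toContinuousLinearEquiv, Q, c, ?_, hL, hQd, hQh, fun w => ?_, hc, hqc, fun w => ?_⟩
  · rw [T₀.finrank_eq]
    simp [add_comm]
  -- Rotating `w` by a unit `z` with `z² Q(w) = -‖Q w‖` turns positivity of `re Q + ‖·‖²` into the
  -- bound on `‖Q w‖`.
  · obtain ⟨z, hz1, hz⟩ : ∃ z : ℂ, ‖z‖ = 1 ∧ z ^ 2 * Q w = -(‖Q w‖ : ℂ) := by
      refine ⟨Complex.exp (Complex.I * ((Real.pi - (Q w).arg) / 2 : ℝ)), ?_, ?_⟩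
      · rw [mul_comm, Complex.norm_exp_ofReal_mul_I]
      · rw [← Complex.exp_nat_mul]
        nth_rewrite 2 [← Complex.norm_mul_exp_arg_mul_I (Q w)]
        rw [mul_left_comm, ← Complex.exp_add]
        rw [show ((2 : ℕ) : ℂ) * (Complex.I * ((Real.pi - (Q w).arg) / 2 : ℝ)) +
          (Q w).arg * Complex.I = Real.pi * Complex.I by push_cast; ring, Complex.exp_pi_mul_I]
        ring
    have h1 := hqc (z • w)
    rw [hQh, hz, norm_smul, hz1, one_mul, Complex.neg_re, Complex.ofReal_re] at h1
    have : 0 ≤ c * ‖w‖ ^ 2 := by positivity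
    linarith
  · change H (T₀.symm (0, w)) (T₀.symm (0, w)) = _
    rw [hT₀, hre]
    change _ = 2 * (H _ _ / 2)
    ring

/-- A linear isomorphism of `ℂ × ℂᵐ` with `ℂᵐ⁺¹` that preserves the Euclidean norms. -/
theorem exists_equiv_norm_sq_eq_sqNorm {n m : ℕ} (h : n = m + 1) :
    ∃ J : (ℂ × EuclideanSpace ℂ (Fin m)) ≃L[ℂ] EuclideanSpace ℂ (Fin n),
      ∀ y, ‖J y‖ ^ 2 = sqNorm y := by
  have hr : Module.finrank ℂ (WithLp 2 (ℂ × EuclideanSpace ℂ (Fin m))) = n := by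
    rw [(WithLp.linearEquiv 2 ℂ (ℂ × EuclideanSpace ℂ (Fin m))).finrank_eq]
    simp [h, add_comm]
  let b := (stdOrthonormalBasis ℂ (WithLp 2 (ℂ × EuclideanSpace ℂ (Fin m)))).reindex (finCongr hr)
  refine ⟨(WithLp.prodContinuousLinearEquiv 2 ℂ ℂ (EuclideanSpace ℂ (Fin m))).symm.trans
    b.repr.toContinuousLinearEquiv, fun y => ?_⟩
  change ‖b.repr _‖ ^ 2 = _
  rw [LinearIsometryEquiv.norm_map, WithLp.prod_norm_sq_eq_of_L2]
  rfl

/-! ### Second-order estimates for a real function -/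

section Real

variable {E : Type*} [NormedAddCommGroup E] [NormedSpace ℝ E]

/-- Second-order Taylor expansion, uniform in the base point, with the Hessian at a fixed point. -/
theorem ContDiffAt.exists_uniform_taylor {ρ : E → ℝ} {p : E} (h : ContDiffAt ℝ 2 ρ p) {ε : ℝ}
    (hε : 0 < ε) :
    ∃ r > (0 : ℝ), ∀ x, ‖x - p‖ < r → ∀ v, ‖v‖ < r →
      |ρ (x + v) - ρ x - fderiv ℝ ρ x v - fderiv ℝ (fderiv ℝ ρ) p v v / 2| ≤ ε * ‖v‖ ^ 2 := by
  set H := fderiv ℝ (fderiv ℝ ρ) p with hH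
  have hsymm (v w : E) : H v w = H w v := h.isSymmSndFDerivAt (by simp) v w
  have h1 : HasStrictFDerivAt (fderiv ℝ ρ) H p :=
    (h.fderiv_right (m := 1) (by norm_num)).hasStrictFDerivAt one_ne_zero
  have h2 := h1.isLittleO.def hε
  have h3 : ∀ᶠ y in 𝓝 p, DifferentiableAt ℝ ρ y :=
    (h.eventually (by simp)).mono fun y hy => hy.differentiableAt two_ne_zero
  obtain ⟨r₁, hr₁, hr₁'⟩ := Metric.eventually_nhds_iff.1 h2
  obtain ⟨r₂, hr₂, hr₂'⟩ := Metric.eventually_nhds_iff.1 h3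
  refine ⟨min (r₁ / 2) (r₂ / 2), by positivity, fun x hx v hv => ?_⟩
  have hx1 := hx.trans_le (min_le_left _ _)
  have hx2 := hx.trans_le (min_le_right _ _)
  have hv1 := hv.trans_le (min_le_left _ _)
  have hv2 := hv.trans_le (min_le_right _ _)
  -- The mean value inequality is applied to the Taylor remainder; strict differentiability of
  -- `fderiv ℝ ρ` at `p` bounds its derivative uniformly in the base point `x`.
  have hd (u : E) (hu : u ∈ Metric.closedBall 0 ‖v‖) : HasFDerivAt
      (fun u => ρ (x + u) - fderiv ℝ ρ x u - H u u / 2) (fderiv ℝ ρ (x + u) - fderiv ℝ ρ x - H u)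
      u := by
    rw [mem_closedBall_zero_iff] at hu
    have e1 : HasFDerivAt (fun u => ρ (x + u)) (fderiv ℝ ρ (x + u)) u := by
      rw [hasFDerivAt_comp_add_left]
      refine (hr₂' ?_).hasFDerivAt
      have : x + u - p = (x - p) + u := by abel
      rw [dist_eq_norm, this]
      linarith [norm_add_le (x - p) u]
    have e2 : HasFDerivAt (fun u => H u u) (H.precompR E u (.id ℝ E) + H.precompL E (.id ℝ E) u) u :=
      H.hasFDerivAt_of_bilinear (hasFDerivAt_id u) (hasFDerivAt_id u)
    refine ((e1.sub (fderiv ℝ ρ x).hasFDerivAt).sub (e2.mul_const (2⁻¹ : ℝ))).congr_fderiv ?_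
    ext w
    simp [hsymm w u]
    ring
  have hb (u : E) (hu : u ∈ Metric.closedBall 0 ‖v‖) :
      ‖fderiv ℝ ρ (x + u) - fderiv ℝ ρ x - H u‖ ≤ ε * ‖v‖ := by
    rw [mem_closedBall_zero_iff] at hu
    have := hr₁' (y := (x + u, x)) (by
      rw [dist_eq_norm, Prod.norm_def]
      have : x + u - p = (x - p) + u := by abel
      refine max_lt ?_ ?_
      · simp only [Prod.fst_sub, this]
        linarith [norm_add_le (x - p) u]
      · simp only [Prod.snd_sub]
        linarith)
    simp only [add_sub_cancel_left] at this
    exact this.trans (by gcongr)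
  have := (convex_closedBall (0 : E) ‖v‖).norm_image_sub_le_of_norm_hasFDerivWithin_le
    (fun u hu => (hd u hu).hasFDerivWithinAt) hb (x := 0) (y := v) (by simp) (by simp)
  simp only [Real.norm_eq_abs, add_zero, map_zero, sub_zero, zero_div] at this
  rw [pow_two, ← mul_assoc]
  convert this using 2
  ring

theorem ContDiffAt.exists_fderiv_sub_le {ρ : E → ℝ} {p : E} (h : ContDiffAt ℝ 2 ρ p) {ε : ℝ}
    (hε : 0 < ε) : ∃ r > (0 : ℝ), ∀ x, ‖x - p‖ < r → ‖fderiv ℝ ρ x - fderiv ℝ ρ p‖ ≤ ε := by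
  have h1 : ContinuousAt (fderiv ℝ ρ) p :=
    (h.fderiv_right (m := 1) (by norm_num)).continuousAt
  obtain ⟨r, hr, h2⟩ := Metric.continuousAt_iff.1 h1 ε hε
  exact ⟨r, hr, fun x hx => by
    have := h2 (x := x) (by rwa [dist_eq_norm])
    rw [dist_eq_norm] at this
    exact this.le⟩

/-- Project `v` to `ker l` along a vector `e` with `l e = 1`; the change in `‖v‖²` and in `H v v` is
`O(|l v| ‖v‖)`. -/
theorem exists_mul_sq_le_of_pos_on_ker [FiniteDimensional ℝ E] {l : E →L[ℝ] ℝ} (hl : l ≠ 0)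
    {H : E →L[ℝ] E →L[ℝ] ℝ} (hp : ∀ v, v ≠ 0 → l v = 0 → 0 < H v v) :
    ∃ c > (0 : ℝ), ∃ C > (0 : ℝ), ∀ v, c * ‖v‖ ^ 2 ≤ H v v + C * (|l v| * ‖v‖) := by
  obtain ⟨e, he⟩ : ∃ e, l e = 1 := by
    obtain ⟨u, hu⟩ : ∃ u, l u ≠ 0 := by
      by_contra! hcon
      exact hl (by ext v; simp [hcon])
    exact ⟨(l u)⁻¹ • u, by simp [hu]⟩
  obtain ⟨c, hc, hcq⟩ := exists_pos_mul_sq_le (V := l.ker) (q := fun v => H v v) (by fun_prop)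
    (fun r v => by simp; ring) (fun v hv => hp v (by simpa using hv) v.2)
  have key (v : E) : c * ‖v - l v • e‖ ^ 2 ≤ H (v - l v • e) (v - l v • e) :=
    hcq ⟨v - l v • e, by simp [he]⟩
  have hc' : 0 ≤ c := hc.le
  refine ⟨c, hc, (2 * c * ‖e‖ + ‖H‖ * ‖e‖ * (2 + ‖l‖ * ‖e‖)) + 1, by positivity, fun v => ?_⟩
  have h1 : ‖v‖ ≤ ‖v - l v • e‖ + |l v| * ‖e‖ := by
    have := norm_add_le (v - l v • e) (l v • e)
    rwa [sub_add_cancel, norm_smul, Real.norm_eq_abs] at this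
  have h2 : ‖v‖ ^ 2 ≤ ‖v - l v • e‖ ^ 2 + 2 * ‖e‖ * (|l v| * ‖v‖) := by
    rcases le_total ‖v‖ (|l v| * ‖e‖) with h | h
    · have : ‖v‖ * ‖v‖ ≤ ‖v‖ * (|l v| * ‖e‖) := by gcongr
      have h0 : 0 ≤ ‖v‖ * (|l v| * ‖e‖) := by positivity
      nlinarith [sq_nonneg ‖v - l v • e‖]
    · have : (‖v‖ - |l v| * ‖e‖) ^ 2 ≤ ‖v - l v • e‖ ^ 2 :=
        pow_le_pow_left₀ (by linarith) (by linarith) 2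
      nlinarith [sq_nonneg (|l v| * ‖e‖)]
  have h3 : H (v - l v • e) (v - l v • e) ≤
      H v v + ‖H‖ * ‖e‖ * (2 + ‖l‖ * ‖e‖) * (|l v| * ‖v‖) := by
    have e1 : H (v - l v • e) (v - l v • e) = H v v + (-(H v (l v • e)) - H (l v • e) v +
        H (l v • e) (l v • e)) := by simp; ring
    rw [e1]
    gcongr
    have hn : ‖l v • e‖ = |l v| * ‖e‖ := by rw [norm_smul, Real.norm_eq_abs]
    have b1 := (neg_le_abs _).trans (H.le_opNorm₂ v (l v • e))
    have b2 := (neg_le_abs _).trans (H.le_opNorm₂ (l v • e) v)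
    have b3 := (le_abs_self _).trans (H.le_opNorm₂ (l v • e) (l v • e))
    have b4 : |l v| ≤ ‖l‖ * ‖v‖ := l.le_opNorm v
    have b5 : ‖H‖ * ‖l v • e‖ * ‖l v • e‖ ≤ ‖H‖ * (|l v| * ‖e‖) * ((‖l‖ * ‖v‖) * ‖e‖) := by
      rw [hn]; gcongr
    rw [hn] at b1 b2
    linarith
  have h4 := key v
  have h5 : c * ‖v‖ ^ 2 ≤ c * (‖v - l v • e‖ ^ 2 + 2 * ‖e‖ * (|l v| * ‖v‖)) := by gcongr
  have h6 : 0 ≤ |l v| * ‖v‖ := by positivity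
  linarith

/-- Near a strongly convex boundary point, the domain lies on one side of the tangent hyperplanes
at the nearby boundary points. -/
theorem exists_fderiv_neg_of_neg [FiniteDimensional ℝ E] {ρ : E → ℝ} {p : E}
    (h : ContDiffAt ℝ 2 ρ p) (hl : fderiv ℝ ρ p ≠ 0)
    (hp : ∀ v, v ≠ 0 → fderiv ℝ ρ p v = 0 → 0 < fderiv ℝ (fderiv ℝ ρ) p v v) :
    ∃ r > (0 : ℝ), ∀ x, ‖x - p‖ < r → ρ x = 0 → ∀ v, ‖v‖ < r → ρ (x + v) < 0 →
      fderiv ℝ ρ x v < 0 := by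
  obtain ⟨c, hc, C, hC, hcC⟩ := exists_mul_sq_le_of_pos_on_ker hl hp
  set ε : ℝ := c / (2 * C + 4) with hε_def
  have hε : 0 < ε := by positivity
  have hεc : ε * (2 * C + 4) = c := by rw [hε_def]; field_simp
  obtain ⟨r₁, hr₁, h1⟩ := h.exists_uniform_taylor hε
  obtain ⟨r₂, hr₂, h2⟩ := h.exists_fderiv_sub_le hε
  refine ⟨min r₁ (min r₂ C⁻¹), by positivity, fun x hx hx0 v hv hneg => ?_⟩
  have t1 := h1 x (hx.trans_le (min_le_left _ _)) v (hv.trans_le (min_le_left _ _))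
  have t2 := h2 x (hx.trans_le ((min_le_right _ _).trans (min_le_left _ _)))
  have hvC : ‖v‖ < C⁻¹ := hv.trans_le ((min_le_right _ _).trans (min_le_right _ _))
  -- If `dρ_x v ≥ 0`, the Hessian can only be negative through a term `C |dρ_p v| ‖v‖`. For `‖v‖ <
  -- C⁻¹` half of it is absorbed by `dρ_x v`, up to `O(ε ‖v‖²)`, so Taylor's formula gives `ρ (x +
  -- v) ≥ 0`.
  by_contra! hcon
  have t3 : |fderiv ℝ ρ p v| ≤ fderiv ℝ ρ x v + ε * ‖v‖ := by
    have := ((fderiv ℝ ρ x - fderiv ℝ ρ p).le_opNorm v).trans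
      (mul_le_mul_of_nonneg_right t2 (norm_nonneg v))
    rw [sub_apply, Real.norm_eq_abs, abs_sub_comm] at this
    have h4 := abs_add_le (fderiv ℝ ρ p v - fderiv ℝ ρ x v) (fderiv ℝ ρ x v)
    rw [sub_add_cancel, abs_of_nonneg hcon] at h4
    linarith
  have t4 := hcC v
  have t5 : C * (|fderiv ℝ ρ p v| * ‖v‖) ≤ C * ((fderiv ℝ ρ x v + ε * ‖v‖) * ‖v‖) := by gcongr
  have t6 : C * (fderiv ℝ ρ x v * ‖v‖) ≤ fderiv ℝ ρ x v := by
    have : C * ‖v‖ ≤ 1 := by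
      have := mul_lt_mul_of_pos_left hvC hC
      rw [mul_inv_cancel₀ hC.ne'] at this
      exact this.le
    nlinarith
  have t7 := (abs_le.1 t1).1
  rw [hx0] at t7
  have t8 : c * ‖v‖ ^ 2 = ε * (2 * C + 4) * ‖v‖ ^ 2 := by rw [hεc]
  have t9 : 0 ≤ ε * ‖v‖ ^ 2 := by positivity
  nlinarith

end Real

/-! ### Uniform linear charts at nearby points -/

section Chart

variable {E : Type*} [NormedAddCommGroup E] [NormedSpace ℂ E] [FiniteDimensional ℂ E]

/-- Only the first coordinate changes: it becomes the complex functional with real part `l`. Testing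
on `v` and `I • v` shows that it is close to the old one, and a small perturbation of an isomorphism
is an isomorphism. The constant `C` does not depend on `l`. -/
theorem exists_perturbed_equiv {W : Type*} [NormedAddCommGroup W] [NormedSpace ℂ W]
    [FiniteDimensional ℂ W] (T : E ≃L[ℂ] ℂ × W) :
    ∃ C ≥ (1 : ℝ), ∀ ε > (0 : ℝ), 4 * C * ε ≤ 1 → ∀ l : E →L[ℝ] ℝ,
      (∀ v, |l v - (T v).1.re| ≤ ε * ‖v‖) → ∃ Ψ : E ≃L[ℂ] ℂ × W,
        (∀ v, (Ψ v).1.re = l v) ∧ (∀ v, (Ψ v).2 = (T v).2) ∧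
        (∀ v, ‖(Ψ v).1 - (T v).1‖ ≤ 2 * ε * ‖v‖) ∧ (∀ v, ‖Ψ v‖ ≤ C * ‖v‖) ∧
        ∀ v, ‖v‖ ≤ C * ‖Ψ v‖ := by
  set A := ‖(T : E →L[ℂ] ℂ × W)‖ + ‖(T.symm : ℂ × W →L[ℂ] E)‖ + 1 with hA
  have hA1 : 1 ≤ A := by
    rw [hA]
    linarith [norm_nonneg (T : E →L[ℂ] ℂ × W), norm_nonneg (T.symm : ℂ × W →L[ℂ] E)]
  have hT1 (v : E) : ‖T v‖ ≤ A * ‖v‖ := by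
    refine ((T : E →L[ℂ] ℂ × W).le_opNorm v).trans ?_
    gcongr
    linarith [norm_nonneg (T.symm : ℂ × W →L[ℂ] E)]
  have hT2 (v : E) : ‖v‖ ≤ A * ‖T v‖ := by
    have := (T.symm : ℂ × W →L[ℂ] E).le_opNorm (T v)
    rw [ContinuousLinearEquiv.coe_coe, T.symm_apply_apply] at this
    refine this.trans ?_
    gcongr
    linarith [norm_nonneg (T : E →L[ℂ] ℂ × W)]
  refine ⟨2 * A, by linarith, fun ε hε hεA l hl => ?_⟩
  obtain ⟨L, hL⟩ : ∃ L : E →ₗ[ℂ] ℂ, ∀ v, (L v).re = l v :=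
    ⟨Module.Dual.extendRCLike l.toLinearMap, fun v =>
      Module.Dual.re_extendRCLike_apply (𝕜 := ℂ) l.toLinearMap v⟩
  have hLT (v : E) : ‖L v - (T v).1‖ ≤ 2 * ε * ‖v‖ := by
    refine (Complex.norm_le_abs_re_add_abs_im _).trans ?_
    have h1 := hl v
    have h2 := hl (Complex.I • v)
    rw [← hL, ← Complex.sub_re] at h1 h2
    rw [norm_smul, Complex.norm_I, one_mul, map_smul, map_smul, Prod.smul_fst, ← smul_sub,
      smul_eq_mul, Complex.I_mul_re, abs_neg] at h2
    linarith
  let f : E →ₗ[ℂ] ℂ × W := L.prod (LinearMap.snd ℂ ℂ W ∘ₗ T.toLinearEquiv.toLinearMap)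
  have hf1 (v : E) : (f v).1 = L v := rfl
  have hf2 (v : E) : (f v).2 = (T v).2 := rfl
  have hfT (v : E) : ‖f v - T v‖ ≤ 2 * ε * ‖v‖ := by
    rw [Prod.norm_def, Prod.fst_sub, Prod.snd_sub, hf1, hf2, sub_self, norm_zero]
    exact max_le (hLT v) (by positivity)
  have hup (v : E) : ‖f v‖ ≤ 2 * A * ‖v‖ := by
    have h1 := norm_add_le (f v - T v) (T v)
    rw [sub_add_cancel] at h1
    have h2 : 2 * ε * ‖v‖ ≤ A * ‖v‖ := by gcongr; nlinarith
    linarith [hfT v, hT1 v]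
  have hlow (v : E) : ‖v‖ ≤ 2 * A * ‖f v‖ := by
    have h1 := norm_sub_le (f v) (f v - T v)
    rw [sub_sub_cancel] at h1
    have h2 : ‖v‖ ≤ A * (‖f v‖ + 2 * ε * ‖v‖) :=
      (hT2 v).trans (by gcongr; linarith [hfT v])
    have h3 : 4 * (2 * A) * ε * ‖v‖ ≤ 1 * ‖v‖ := by gcongr
    have h4 : 0 ≤ A * ‖f v‖ := by positivity
    linarith
  have hinj : Function.Injective f := by
    rw [injective_iff_map_eq_zero]
    intro v hv
    have := hlow v
    rw [hv, norm_zero, mul_zero] at this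
    exact norm_le_zero_iff.1 this
  exact ⟨(f.linearEquivOfInjective hinj T.toLinearEquiv.finrank_eq).toContinuousLinearEquiv,
    hL, hf2, hLT, hup, hlow⟩

/-- Holomorphic linear coordinates at the points near `p` in which a `C²` function is uniformly
close to a fixed quadratic normal form. -/
theorem ContDiffAt.exists_uniform_chart {ρ : E → ℝ} {p : E} (h : ContDiffAt ℝ 2 ρ p)
    {W : Type*} [NormedAddCommGroup W] [NormedSpace ℂ W] [FiniteDimensional ℂ W]
    {T : E ≃L[ℂ] ℂ × W} (hT : ∀ v, (T v).1.re = fderiv ℝ ρ p v) {Q : W → ℂ}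
    (hQ : ∀ w, fderiv ℝ (fderiv ℝ ρ) p (T.symm (0, w)) (T.symm (0, w)) =
      2 * ((Q w).re + ‖w‖ ^ 2)) :
    ∃ C ≥ (1 : ℝ), ∀ ε > (0 : ℝ), ∃ r > (0 : ℝ), ∀ x, ‖x - p‖ < r → ∃ Ψ : E ≃L[ℂ] ℂ × W,
      (∀ v, (Ψ v).1.re = fderiv ℝ ρ x v) ∧ (∀ v, (Ψ v).2 = (T v).2) ∧
      (∀ v, ‖(Ψ v).1 - (T v).1‖ ≤ ε * ‖v‖) ∧ (∀ v, ‖Ψ v‖ ≤ C * ‖v‖) ∧ (∀ v, ‖v‖ ≤ C * ‖Ψ v‖) ∧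
      ∀ v, ‖v‖ < r →
        |ρ (x + v) - ρ x - ((Ψ v).1.re + ((Q (Ψ v).2).re + ‖(Ψ v).2‖ ^ 2))| ≤
          ε * (‖(Ψ v).2‖ ^ 2 + ‖(Ψ v).1‖) := by
  obtain ⟨C, hC1, hC⟩ := exists_perturbed_equiv T
  have hC0 : 0 < C := by linarith
  set H := fderiv ℝ (fderiv ℝ ρ) p with hH
  obtain ⟨B, hB0, hB⟩ : ∃ B ≥ (0 : ℝ), ∀ y, ‖T.symm y‖ ≤ B * ‖y‖ :=
    ⟨_, norm_nonneg _, (T.symm : ℂ × W →L[ℂ] E).le_opNorm⟩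
  -- The Hessian at `v` is compared with its value at the component `u` of `v` in the complex
  -- tangent space; the difference carries a factor `‖(T v).1‖`.
  obtain ⟨K, hK0, hK⟩ : ∃ K ≥ (0 : ℝ), ∀ v,
      |H v v / 2 - ((Q (T v).2).re + ‖(T v).2‖ ^ 2)| ≤ K * (‖(T v).1‖ * ‖v‖) := by
    refine ⟨‖H‖ * B * (1 + B * ‖(T : E →L[ℂ] ℂ × W)‖), by positivity, fun v => ?_⟩
    set u := T.symm (0, (T v).2) with hu
    have huv : v - u = T.symm ((T v).1, 0) := by
      apply T.injective
      rw [map_sub, hu, T.apply_symm_apply, T.apply_symm_apply]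
      ext1 <;> simp
    have h1 : ‖u‖ ≤ B * ‖(T : E →L[ℂ] ℂ × W)‖ * ‖v‖ := by
      refine (hB _).trans ?_
      rw [mul_assoc]
      gcongr
      refine le_trans ?_ ((T : E →L[ℂ] ℂ × W).le_opNorm v)
      rw [Prod.norm_def, norm_zero]
      exact max_le (norm_nonneg _) (norm_snd_le (T v))
    have h2 : ‖v - u‖ ≤ B * ‖(T v).1‖ := by
      rw [huv]
      refine (hB _).trans (le_of_eq ?_)
      rw [Prod.norm_def, norm_zero, max_eq_left (norm_nonneg _)]
    have h3 : H v v / 2 - ((Q (T v).2).re + ‖(T v).2‖ ^ 2) =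
        (H (v - u) v + H u (v - u)) / 2 := by
      have := hQ (T v).2
      rw [← hu] at this
      simp only [map_sub, sub_apply]
      linarith
    have h4 := (H.le_opNorm₂ (v - u) v)
    have h5 := (H.le_opNorm₂ u (v - u))
    rw [Real.norm_eq_abs] at h4 h5
    have h6 : ‖H‖ * ‖v - u‖ * ‖v‖ ≤ ‖H‖ * (B * ‖(T v).1‖) * ‖v‖ := by gcongr
    have h7 : ‖H‖ * ‖u‖ * ‖v - u‖ ≤
        ‖H‖ * (B * ‖(T : E →L[ℂ] ℂ × W)‖ * ‖v‖) * (B * ‖(T v).1‖) := by gcongr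
    rw [h3, abs_div, abs_two]
    have h8 := abs_add_le (H (v - u) v) (H u (v - u))
    have h9 := abs_nonneg (H (v - u) v + H u (v - u))
    linarith
  refine ⟨C, hC1, fun ε hε => ?_⟩
  set ε₁ : ℝ := min (1 / (4 * C)) (min (ε / 2) (ε / (4 * (1 + K) * C ^ 2))) with hε₁_def
  have hε₁ : 0 < ε₁ := by positivity
  have hε₁1 : 4 * C * ε₁ ≤ 1 := by
    have : ε₁ ≤ 1 / (4 * C) := min_le_left _ _
    rw [le_div_iff₀ (by positivity)] at this
    linarith
  have hε₁2 : 2 * ε₁ ≤ ε := by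
    have : ε₁ ≤ ε / 2 := (min_le_right _ _).trans (min_le_left _ _)
    linarith
  have hε₁3 : (ε₁ + 2 * K * ε₁) * C ^ 2 ≤ ε / 2 := by
    have : ε₁ ≤ ε / (4 * (1 + K) * C ^ 2) := (min_le_right _ _).trans (min_le_right _ _)
    rw [le_div_iff₀ (by positivity)] at this
    have h0 : 0 ≤ ε₁ * C ^ 2 := by positivity
    nlinarith
  obtain ⟨r₁, hr₁, hr₁'⟩ := h.exists_uniform_taylor hε₁
  obtain ⟨r₂, hr₂, hr₂'⟩ := h.exists_fderiv_sub_le hε₁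
  refine ⟨min (min r₁ r₂) (ε / (2 * (ε * C + K + 1))), by positivity, fun x hx => ?_⟩
  have hx1 := hx.trans_le ((min_le_left _ _).trans (min_le_left _ _))
  have hx2 := hx.trans_le ((min_le_left _ _).trans (min_le_right _ _))
  obtain ⟨Ψ, h1, h2, h3, h4, h5⟩ := hC ε₁ hε₁ hε₁1 (fderiv ℝ ρ x) fun v => by
    rw [hT, ← Real.norm_eq_abs, ← sub_apply]
    exact ((fderiv ℝ ρ x - fderiv ℝ ρ p).le_opNorm v).trans
      (mul_le_mul_of_nonneg_right (hr₂' x hx2) (norm_nonneg v))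
  refine ⟨Ψ, h1, h2, fun v => (h3 v).trans (by gcongr), h4, h5, fun v hv => ?_⟩
  have hv1 := hv.trans_le ((min_le_left _ _).trans (min_le_left _ _))
  have hv2 : ‖v‖ * (2 * (ε * C + K + 1)) < ε :=
    (lt_div_iff₀ (by positivity)).1 (hv.trans_le (min_le_right _ _))
  have t1 := hr₁' x hx1 v hv1
  have t2 := hK v
  rw [← h2, ← hH] at *
  have t3 : ‖(T v).1‖ ≤ ‖(Ψ v).1‖ + 2 * ε₁ * ‖v‖ := by
    have := norm_sub_le (Ψ v).1 ((Ψ v).1 - (T v).1)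
    rw [sub_sub_cancel] at this
    linarith [h3 v]
  have t4 : K * (‖(T v).1‖ * ‖v‖) ≤ K * ((‖(Ψ v).1‖ + 2 * ε₁ * ‖v‖) * ‖v‖) := by gcongr
  -- A Taylor error `‖v‖²` is controlled by `‖w‖²` plus `‖v‖ ‖a‖`, and the latter is a small
  -- multiple of `‖a‖` when `v` is small.
  have t5 : ‖v‖ ^ 2 ≤ C ^ 2 * ‖(Ψ v).2‖ ^ 2 + C ^ 2 * (C * ‖v‖ * ‖(Ψ v).1‖) := by
    have a1 : ‖v‖ ^ 2 ≤ C ^ 2 * ‖Ψ v‖ ^ 2 := by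
      rw [← mul_pow]
      exact pow_le_pow_left₀ (norm_nonneg _) (h5 v) 2
    have a2 : ‖Ψ v‖ ^ 2 ≤ ‖(Ψ v).2‖ ^ 2 + C * ‖v‖ * ‖(Ψ v).1‖ := by
      rcases max_choice ‖(Ψ v).1‖ ‖(Ψ v).2‖ with h | h
      · have b1 : ‖Ψ v‖ = ‖(Ψ v).1‖ := by rw [Prod.norm_def, h]
        have b2 := h4 v
        have b3 : ‖Ψ v‖ * ‖(Ψ v).1‖ ≤ C * ‖v‖ * ‖(Ψ v).1‖ := by gcongr
        have b4 : ‖Ψ v‖ ^ 2 = ‖Ψ v‖ * ‖(Ψ v).1‖ := by rw [← b1, pow_two]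
        linarith [sq_nonneg ‖(Ψ v).2‖]
      · have b1 : ‖Ψ v‖ = ‖(Ψ v).2‖ := by rw [Prod.norm_def, h]
        rw [b1]
        have : 0 ≤ C * ‖v‖ * ‖(Ψ v).1‖ := by positivity
        linarith
    have a3 : C ^ 2 * ‖Ψ v‖ ^ 2 ≤ C ^ 2 * (‖(Ψ v).2‖ ^ 2 + C * ‖v‖ * ‖(Ψ v).1‖) := by gcongr
    linarith
  have t6 : (ε₁ + 2 * K * ε₁) * ‖v‖ ^ 2 ≤ ε / 2 * (‖(Ψ v).2‖ ^ 2 + C * ‖v‖ * ‖(Ψ v).1‖) := by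
    calc _ ≤ (ε₁ + 2 * K * ε₁) * (C ^ 2 * ‖(Ψ v).2‖ ^ 2 + C ^ 2 * (C * ‖v‖ * ‖(Ψ v).1‖)) := by
          gcongr
      _ = ((ε₁ + 2 * K * ε₁) * C ^ 2) * (‖(Ψ v).2‖ ^ 2 + C * ‖v‖ * ‖(Ψ v).1‖) := by ring
      _ ≤ _ := by gcongr
  have t7 : (ε * C + K) * ‖v‖ * ‖(Ψ v).1‖ ≤ ε / 2 * ‖(Ψ v).1‖ := by
    gcongr
    linarith [norm_nonneg v]
  have t8 : 0 ≤ ε * C * ‖v‖ * ‖(Ψ v).1‖ := by positivity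
  have t9 : 0 ≤ ε * ‖(Ψ v).2‖ ^ 2 := by positivity
  have t11 : 0 ≤ ε * ‖(Ψ v).1‖ := by positivity
  have t10 : ρ (x + v) - ρ x - ((Ψ v).1.re + ((Q (Ψ v).2).re + ‖(Ψ v).2‖ ^ 2)) =
      (ρ (x + v) - ρ x - fderiv ℝ ρ x v - H v v / 2) +
        (H v v / 2 - ((Q (Ψ v).2).re + ‖(Ψ v).2‖ ^ 2)) := by
    rw [h1]; ring
  rw [t10]
  refine (abs_add_le _ _).trans ?_
  linarith

end Chart

/-! ### Position of the domain relative to the tangent hyperplanes -/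

theorem HasFDerivAt.eventually_pos {E : Type*} [NormedAddCommGroup E] [NormedSpace ℝ E]
    {ρ : E → ℝ} {p : E} {l : E →L[ℝ] ℝ} (h : HasFDerivAt ρ l p) (h0 : ρ p = 0) {v : E}
    (hv : 0 < l v) : ∀ᶠ s in 𝓝[>] (0 : ℝ), 0 < ρ (p + s • v) := by
  have h1 : HasDerivAt (fun s : ℝ => ρ (p + s • v)) (l v) 0 := by
    have h2 : HasDerivAt (fun s : ℝ => p + s • v) v 0 := by
      simpa using ((hasDerivAt_id (0 : ℝ)).smul_const v).const_add p
    have h' : HasFDerivAt ρ l (p + (0 : ℝ) • v) := by simpa using h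
    exact h'.comp_hasDerivAt 0 h2
  have h3 := (hasDerivAt_iff_tendsto_slope.1 h1).mono_left
    (nhdsWithin_mono 0 fun s (hs : 0 < s) => hs.ne')
  filter_upwards [h3.eventually (lt_mem_nhds hv), self_mem_nhdsWithin] with s hs hs0
  rw [slope_def_field, zero_smul, add_zero, h0, sub_zero, sub_zero] at hs
  exact (div_pos_iff_of_pos_right hs0).1 hs

section Domain

variable {n : ℕ} {D U : Set (Cn n)} {p : Cn n} {ρ : Cn n → ℝ}

theorem IsC2DefiningFunction.contDiffAt (h : IsC2DefiningFunction D p U ρ) :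
    ContDiffAt ℝ 2 ρ p :=
  h.contDiffOn.contDiffAt (h.isOpen.mem_nhds h.mem)

theorem IsC2DefiningFunction.mem_iff (h : IsC2DefiningFunction D p U ρ) {z : Cn n} (hz : z ∈ U) :
    z ∈ D ↔ ρ z < 0 := by
  have := Set.ext_iff.1 h.inter_eq z
  simpa [hz] using this

theorem IsC2DefiningFunction.eq_zero (h : IsC2DefiningFunction D p U ρ) (hD : IsOpen D)
    (hp : p ∈ frontier D) : ρ p = 0 := by
  rw [hD.frontier_eq] at hp
  apply le_antisymm
  · have hc : ContinuousAt ρ p := h.contDiffAt.continuousAt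
    by_contra! hcon
    have h0 : ∀ᶠ z in 𝓝 p, z ∈ U := h.isOpen.mem_nhds h.mem
    have h1 : ∀ᶠ z in 𝓝 p, z ∈ U ∧ 0 < ρ z := h0.and (hc.eventually (lt_mem_nhds hcon))
    obtain ⟨z, ⟨hzU, hz⟩, hzD⟩ := mem_closure_iff_nhds.1 hp.1 _ h1
    exact hz.not_gt ((h.mem_iff hzU).1 hzD)
  · by_contra! hcon
    exact hp.2 ((h.mem_iff h.mem).2 hcon)

/-- The connected set `D` misses the tangent hyperplane at `p`, so it lies on one side; points of
`D` just inside `p` tell which. -/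
theorem IsC2DefiningFunction.fderiv_sub_neg (h : IsC2DefiningFunction D p U ρ)
    (hD : IsBoundedDomain D) (hp : p ∈ frontier D)
    (hT : closure D ∩ tangentHyperplane ρ p = {p}) : ∀ z ∈ D, fderiv ℝ ρ p (z - p) < 0 := by
  have h0 := h.eq_zero hD.isOpen hp
  have hpD : p ∉ D := fun hpD => by
    rw [hD.isOpen.frontier_eq] at hp
    exact hp.2 hpD
  have hne (z : Cn n) (hz : z ∈ D) : fderiv ℝ ρ p (z - p) ≠ 0 := fun hz0 => by
    have : z ∈ closure D ∩ tangentHyperplane ρ p := ⟨subset_closure hz, hz0⟩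
    rw [hT, mem_singleton_iff] at this
    exact hpD (this ▸ hz)
  obtain ⟨e, he⟩ : ∃ e, fderiv ℝ ρ p e < 0 := by
    obtain ⟨u, hu⟩ : ∃ u, fderiv ℝ ρ p u ≠ 0 := by
      by_contra! hcon
      exact h.fderiv_ne_zero p h.mem (by ext v; simp [hcon])
    rcases hu.lt_or_gt with hu | hu
    · exact ⟨u, hu⟩
    · exact ⟨-u, by simpa using hu⟩
  obtain ⟨z₀, hz₀, hz₀'⟩ : ∃ z₀ ∈ D, fderiv ℝ ρ p (z₀ - p) < 0 := by
    have h1 := (h.contDiffAt.differentiableAt two_ne_zero).hasFDerivAt.neg.eventually_pos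
      (v := e) (by simp [h0]) (by simpa using he)
    have h2 : ∀ᶠ s in 𝓝[>] (0 : ℝ), p + s • e ∈ U := by
      have : ContinuousAt (fun s : ℝ => p + s • e) 0 := by fun_prop
      refine (this.eventually ?_).filter_mono nhdsWithin_le_nhds
      simpa using h.isOpen.mem_nhds h.mem
    obtain ⟨s, ⟨hs1, hs2⟩, hs3⟩ := ((h1.and h2).and self_mem_nhdsWithin).exists
    refine ⟨p + s • e, (h.mem_iff hs2).2 (by simpa using hs1), ?_⟩
    rw [add_sub_cancel_left, map_smul, smul_eq_mul]
    exact mul_neg_of_pos_of_neg hs3 he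
  intro z hz
  by_contra! hcon
  have hcont : ContinuousOn (fun z => fderiv ℝ ρ p (z - p)) D := by fun_prop
  obtain ⟨y, hy, hy0⟩ := hD.isConnected.isPreconnected.intermediate_value hz₀ hz hcont
    ⟨hz₀'.le, hcon⟩
  exact hne y hy hy0

/-- At `p` itself compactness of `closure D` minus a ball gives the bound `-2δ`. Moving the
functional and the base point from `p` to `x` costs at most `δ / 2` each. -/
theorem IsC2DefiningFunction.exists_fderiv_sub_le_neg (h : IsC2DefiningFunction D p U ρ)
    (hD : IsBoundedDomain D) (hp : p ∈ frontier D)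
    (hT : closure D ∩ tangentHyperplane ρ p = {p}) {r : ℝ} (hr : 0 < r) :
    ∃ δ > (0 : ℝ), ∃ r' > (0 : ℝ), ∀ x, ‖x - p‖ < r' → ∀ z ∈ D, r ≤ ‖z - x‖ →
      fderiv ℝ ρ x (z - x) ≤ -δ := by
  obtain ⟨δ, hδ, hδ'⟩ : ∃ δ > (0 : ℝ), ∀ z ∈ closure D \ Metric.ball p (r / 2),
      fderiv ℝ ρ p (z - p) ≤ -(2 * δ) := by
    have hK : IsCompact (closure D \ Metric.ball p (r / 2)) :=
      hD.isBounded.isCompact_closure.diff Metric.isOpen_ball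
    have hcont : Continuous fun z => fderiv ℝ ρ p (z - p) := by fun_prop
    rcases (closure D \ Metric.ball p (r / 2)).eq_empty_or_nonempty with hE | hE
    · exact ⟨1, one_pos, by simp [hE]⟩
    · obtain ⟨z₀, hz₀, hmax⟩ := hK.exists_isMaxOn hE hcont.continuousOn
      have h1 : fderiv ℝ ρ p (z₀ - p) ≤ 0 :=
        closure_minimal (fun z hz => (h.fderiv_sub_neg hD hp hT z hz).le)
          (isClosed_le hcont continuous_const) hz₀.1
      have h2 : fderiv ℝ ρ p (z₀ - p) ≠ 0 := fun h0 => by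
        have : z₀ ∈ closure D ∩ tangentHyperplane ρ p := ⟨hz₀.1, h0⟩
        rw [hT, mem_singleton_iff] at this
        exact hz₀.2 (this ▸ Metric.mem_ball_self (by positivity))
      refine ⟨-fderiv ℝ ρ p (z₀ - p) / 2, by linarith [h1.lt_of_ne h2], fun z hz => ?_⟩
      have : fderiv ℝ ρ p (z - p) ≤ fderiv ℝ ρ p (z₀ - p) := hmax hz
      linarith
  obtain ⟨R, hR0, hR⟩ : ∃ R > (0 : ℝ), ∀ z ∈ D, ‖z - p‖ ≤ R := by
    obtain ⟨R, hR⟩ := hD.isBounded.subset_closedBall p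
    exact ⟨max R 1, by positivity, fun z hz => by
      have := hR hz
      rw [mem_closedBall_iff_norm] at this
      exact this.trans (le_max_left _ _)⟩
  obtain ⟨r₁, hr₁, hr₁'⟩ := h.contDiffAt.exists_fderiv_sub_le (ε := δ / (2 * (R + 1)))
    (by positivity)
  refine ⟨δ, hδ, min (min r₁ (r / 2)) (min 1 (δ / (2 * (‖fderiv ℝ ρ p‖ + 1)))), by positivity,
    fun x hx z hz hzx => ?_⟩
  have hx1 := hx.trans_le ((min_le_left _ _).trans (min_le_left _ _))
  have hx2 := hx.trans_le ((min_le_left _ _).trans (min_le_right _ _))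
  have hx3 := hx.trans_le ((min_le_right _ _).trans (min_le_left _ _))
  have hx4 := hx.trans_le ((min_le_right _ _).trans (min_le_right _ _))
  rw [lt_div_iff₀ (by positivity)] at hx4
  have e1 : z - x = (z - p) - (x - p) := by abel
  have hn : ‖z - x‖ ≤ R + 1 := by
    rw [e1]
    linarith [norm_sub_le (z - p) (x - p), hR z hz]
  have h1 : fderiv ℝ ρ p (z - p) ≤ -(2 * δ) := by
    refine hδ' z ⟨subset_closure hz, fun hb => ?_⟩
    rw [mem_ball_iff_norm] at hb
    have := norm_sub_le (z - p) (x - p)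
    rw [← e1] at this
    linarith
  have h2 : (fderiv ℝ ρ x - fderiv ℝ ρ p) (z - x) ≤ δ / 2 := by
    calc _ ≤ ‖fderiv ℝ ρ x - fderiv ℝ ρ p‖ * ‖z - x‖ :=
          (le_abs_self _).trans ((fderiv ℝ ρ x - fderiv ℝ ρ p).le_opNorm _)
      _ ≤ δ / (2 * (R + 1)) * (R + 1) := by
          gcongr
          exact hr₁' x hx1
      _ = δ / 2 := by field_simp
  have h3 : -(fderiv ℝ ρ p (x - p)) ≤ δ / 2 := by
    have := (neg_le_abs _).trans ((fderiv ℝ ρ p).le_opNorm (x - p))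
    linarith [norm_nonneg (x - p)]
  have h4 : fderiv ℝ ρ x (z - x) =
      (fderiv ℝ ρ x - fderiv ℝ ρ p) (z - x) + fderiv ℝ ρ p (z - p) - fderiv ℝ ρ p (x - p) := by
    rw [add_sub_assoc, ← map_sub, ← e1, sub_apply]
    ring
  linarith

/-! ### Embedding the domain into the ball -/

/-- Near a globally strongly convex boundary point `p`, every point of the domain is sent to `0` by
a holomorphic embedding into the unit ball whose image contains a given smaller ball. -/
theorem IsGloballyStronglyConvexPoint.eventually_exists_holEmb (hD : IsBoundedDomain D)
    (hp : IsGloballyStronglyConvexPoint D p) {η : ℝ} (hη : 0 < η) (hη1 : η ≤ 1) :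
    ∀ᶠ z in 𝓝[D] p, ∃ f : Cn n → Cn n, HolEmb f D ∧ MapsTo f D (Metric.ball 0 1) ∧ f z = 0 ∧
      Metric.ball 0 ((1 - 2 * η) / (1 + 2 * η)) ⊆ f '' D := by
  obtain ⟨hpf, U, ρ, hU, hH, hT⟩ := hp
  have hρ := hU.contDiffAt
  have hρ0 := hU.eq_zero hD.isOpen hpf
  have hl := hU.fderiv_ne_zero p hU.mem
  obtain ⟨m, T, Q, c, hm, hTre, hQd, hQh, hQn, hc, hqc, hHQ⟩ := exists_adapted_coordinates hl
    (H := fderiv ℝ (fderiv ℝ ρ) p) (fun v w => hρ.isSymmSndFDerivAt (by simp) v w) hH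
  rw [finrank_euclideanSpace_fin] at hm
  obtain ⟨J, hJ⟩ := exists_equiv_norm_sq_eq_sqNorm hm
  obtain ⟨ε, hε, hmodel⟩ := exists_holEmb_of_near_quadric hQd hQh hQn hc hqc hη hη1
  set e : Cn n := T.symm (1, 0) with he
  have hTe : T e = (1, 0) := T.apply_symm_apply _
  obtain ⟨C, hC1, hchart⟩ := hρ.exists_uniform_chart hTre hHQ
  have hC0 : 0 < C := by linarith
  -- The tolerance `ε` is the one of the model; `η / (‖e‖ + 1)` keeps `(Ψ e).1` within `η` of `1`.
  obtain ⟨r₁, hr₁, hchart⟩ := hchart (min ε (η / (‖e‖ + 1))) (by positivity)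
  obtain ⟨r₂, hr₂, hneg⟩ := exists_fderiv_neg_of_neg hρ hl hH
  obtain ⟨r₃, hr₃, hrU⟩ := Metric.isOpen_iff.1 hU.isOpen p hU.mem
  obtain ⟨r, hr, hrr₁, hrr₂, hrr₃⟩ : ∃ r > (0 : ℝ), r ≤ r₁ ∧ r ≤ r₂ ∧ 2 * r ≤ r₃ :=
    ⟨min r₁ (min r₂ (r₃ / 2)), by positivity, min_le_left _ _,
      (min_le_right _ _).trans (min_le_left _ _), by
        have : min r₁ (min r₂ (r₃ / 2)) ≤ r₃ / 2 := (min_le_right _ _).trans (min_le_right _ _)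
        linarith⟩
  obtain ⟨δ, hδ, r₄, hr₄, hfar⟩ := hU.exists_fderiv_sub_le_neg hD hpf hT hr
  obtain ⟨R, hR⟩ : ∃ R : ℝ, ∀ z ∈ D, ‖z - p‖ ≤ R := by
    obtain ⟨R, hR⟩ := hD.isBounded.subset_closedBall p
    exact ⟨R, fun z hz => mem_closedBall_iff_norm.1 (hR hz)⟩
  obtain ⟨s₀, hs₀, hmodel⟩ := hmodel (r / C) (by positivity) δ hδ (C * (R + r))
  obtain ⟨r₅, hr₅, hr₅r, hr₅r₄⟩ : ∃ r₅ > (0 : ℝ), r₅ ≤ r ∧ r₅ ≤ r₄ :=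
    ⟨min r r₄, by positivity, min_le_left _ _, min_le_right _ _⟩
  -- The point `p + s₁ • e` is outside `D`, and so is `z₀ + s₁ • e` for `z₀` near `p`; the segment
  -- from `z₀` therefore meets `ρ = 0` at some parameter `t < s₁ < s₀`.
  obtain ⟨s₁, hs₁, hs₁s₀, hs₁e, hs₁ρ⟩ : ∃ s₁ > (0 : ℝ), s₁ < s₀ ∧ s₁ * ‖e‖ < r₅ / 2 ∧
      0 < ρ (p + s₁ • e) := by
    have h1 : 0 < fderiv ℝ ρ p e := by rw [← hTre, hTe]; simp
    have h2 := (hρ.differentiableAt two_ne_zero).hasFDerivAt.eventually_pos hρ0 h1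
    have h3 : ∀ᶠ s in 𝓝[>] (0 : ℝ), s < s₀ :=
      (gt_mem_nhds hs₀ : ∀ᶠ s in 𝓝 (0 : ℝ), s < s₀).filter_mono nhdsWithin_le_nhds
    have h4 : ∀ᶠ s in 𝓝[>] (0 : ℝ), s * ‖e‖ < r₅ / 2 := by
      have : ContinuousAt (fun s : ℝ => s * ‖e‖) 0 := by fun_prop
      refine (this.eventually (gt_mem_nhds ?_)).filter_mono nhdsWithin_le_nhds
      change 0 * ‖e‖ < r₅ / 2
      rw [zero_mul]
      positivity
    obtain ⟨s, ⟨⟨a, b⟩, c⟩, d⟩ := (((h2.and h3).and h4).and self_mem_nhdsWithin).exists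
    exact ⟨s, d, b, c, a⟩
  have hUmem (z : Cn n) (hz : ‖z - p‖ < 2 * r) : z ∈ U :=
    hrU (mem_ball_iff_norm.2 (hz.trans_le hrr₃))
  have hray : ∀ᶠ z in 𝓝[D] p, 0 < ρ (z + s₁ • e) := by
    have h1 : p + s₁ • e ∈ U := hUmem _ (by
      rw [add_sub_cancel_left, norm_smul, Real.norm_of_nonneg hs₁.le]
      linarith)
    have h2 : ContinuousAt ρ (p + s₁ • e) :=
      (hU.contDiffOn.contDiffAt (hU.isOpen.mem_nhds h1)).continuousAt
    have h3 : ContinuousAt (fun z => ρ (z + s₁ • e)) p :=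
      ContinuousAt.comp (f := fun z => z + s₁ • e) h2 (by fun_prop)
    exact (h3.eventually (lt_mem_nhds hs₁ρ)).filter_mono nhdsWithin_le_nhds
  have hclose : ∀ᶠ z in 𝓝[D] p, ‖z - p‖ < r₅ / 2 := by
    have : Metric.ball p (r₅ / 2) ∈ 𝓝 p := Metric.ball_mem_nhds p (by positivity)
    filter_upwards [nhdsWithin_le_nhds this] with z hz using mem_ball_iff_norm.1 hz
  filter_upwards [hray, hclose, self_mem_nhdsWithin] with z₀ hz₀ρ hz₀ hz₀D
  have hseg (s : ℝ) (hs : s ∈ Icc 0 s₁) : ‖z₀ + s • e - p‖ < r₅ := by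
    have h1 : z₀ + s • e - p = (z₀ - p) + s • e := by abel
    have h2 : ‖s • e‖ ≤ s₁ * ‖e‖ := by
      rw [norm_smul, Real.norm_of_nonneg hs.1]
      gcongr
      exact hs.2
    rw [h1]
    linarith [norm_add_le (z₀ - p) (s • e)]
  obtain ⟨t, ⟨ht0, hts₁⟩, ht⟩ : ∃ t ∈ Ioo 0 s₁, ρ (z₀ + t • e) = 0 := by
    have h1 : ContinuousOn (fun s : ℝ => ρ (z₀ + s • e)) (Icc 0 s₁) :=
      hU.contDiffOn.continuousOn.comp (by fun_prop) fun s hs =>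
        hUmem _ (by linarith [hseg s hs])
    have h2 := intermediate_value_Ioo hs₁.le h1
    refine h2 ⟨?_, hz₀ρ⟩
    simpa using (hU.mem_iff (hUmem z₀ (by linarith))).1 hz₀D
  set x := z₀ + t • e with hx
  have hxp : ‖x - p‖ < r₅ := hseg t ⟨ht0.le, hts₁.le⟩
  have hz₀x : z₀ - x = -(t • e) := by rw [hx]; abel
  obtain ⟨Ψ, hΨre, hΨ2, hΨ1, hΨC, hΨC', hΨρ⟩ := hchart x (by linarith)
  have hxU (v : Cn n) (hv : ‖v‖ < r) : x + v ∈ U := by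
    refine hUmem _ ?_
    have h1 : x + v - p = (x - p) + v := by abel
    rw [h1]
    linarith [norm_add_le (x - p) v]
  have hρΨ (v : Cn n) (hv : ‖v‖ < r) :
      |ρ (x + v) - ((Ψ v).1.re + ((Q (Ψ v).2).re + ‖(Ψ v).2‖ ^ 2))| ≤
        ε * (‖(Ψ v).2‖ ^ 2 + ‖(Ψ v).1‖) := by
    have := hΨρ v (by linarith)
    rw [ht, sub_zero] at this
    refine this.trans ?_
    gcongr
    exact min_le_left _ _
  obtain ⟨G, hGemb, hGup, hGlow, hG0⟩ := hmodel ((fun z => Ψ (z - x)) '' D)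
    (by
      rintro _ ⟨z, hz, rfl⟩
      rw [hΨre]
      rcases lt_or_ge ‖z - x‖ r with h | h
      · have h1 := hxU _ h
        have h2 : x + (z - x) = z := by abel
        rw [h2] at h1
        exact hneg x (by linarith) ht _ (by linarith) (by
          rw [h2]
          exact (hU.mem_iff h1).1 hz)
      · linarith [hfar x (by linarith) z hz h])
    (by
      rintro _ ⟨z, hz, rfl⟩
      rcases lt_or_ge ‖z - x‖ r with h | h
      · left
        have h1 := hxU _ h
        have h2 : x + (z - x) = z := by abel
        have h3 := hρΨ _ h
        rw [h2] at h1 h3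
        have h4 := (hU.mem_iff h1).1 hz
        linarith [(abs_le.1 h3).1]
      · right
        refine ⟨by rw [hΨre]; exact hfar x (by linarith) z hz h, ?_⟩
        refine (norm_snd_le _).trans ((hΨC _).trans ?_)
        gcongr
        have h1 : z - x = (z - p) - (x - p) := by abel
        rw [h1]
        linarith [norm_sub_le (z - p) (x - p), hR z hz])
    (by
      intro y hy hy'
      have h1 : ‖Ψ.symm y‖ < r := by
        have h2 := hΨC' (Ψ.symm y)
        rw [Ψ.apply_symm_apply] at h2
        rw [lt_div_iff₀ hC0] at hy
        linarith
      have h3 := hρΨ _ h1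
      rw [Ψ.apply_symm_apply] at h3
      refine ⟨x + Ψ.symm y, (hU.mem_iff (hxU _ h1)).2 ?_, by simp⟩
      linarith [(abs_le.1 h3).2])
    t ht0 (by linarith)
  have hdim : IsOpen ((fun z => Ψ (z - x)) '' D) := by
    have : (fun z => Ψ (z - x)) '' D = (Ψ.toHomeomorph) '' ((Homeomorph.subRight x) '' D) := by
      rw [image_image]; rfl
    rw [this]
    exact Ψ.toHomeomorph.isOpenMap _ ((Homeomorph.subRight x).isOpenMap _ hD.isOpen)
  have hF : HolEmb (fun z => J (G (Ψ (z - x)))) D :=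
    (J.holEmb univ).comp (hGemb.comp (((Ψ.holEmb univ).comp (holEmb_sub_const x D) (mapsTo_univ _ _)
      isOpen_univ) :) (mapsTo_image _ _) hdim) (mapsTo_univ _ _) isOpen_univ
  -- The chart keeps the second coordinate of `T`, so `z₀ - x = -(t • e)` becomes `(-tλ, 0)` with `λ
  -- ≈ 1`, and the Cayley transform at the same scale `t` sends it to `((λ - 1)/(λ + 1), 0)`.
  have hF0 : ‖J (G (Ψ (z₀ - x)))‖ ≤ η := by
    have h1 : Ψ (z₀ - x) = (-(t * (Ψ e).1), 0) := by
      rw [hz₀x, map_neg, ← Complex.coe_smul, map_smul]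
      ext1
      · simp
      · simp [hΨ2, hTe]
    set lam := (Ψ e).1 with hlam
    have h2 : ‖lam - 1‖ ≤ η := by
      have := hΨ1 e
      rw [hTe] at this
      refine this.trans ?_
      calc _ ≤ η / (‖e‖ + 1) * (‖e‖ + 1) := by
            gcongr
            · exact min_le_right _ _
            · linarith
        _ = η := by field_simp
    have h3 : 1 ≤ ‖lam + 1‖ := by
      have h4 := norm_sub_le (lam + 1) (lam - 1)
      rw [show lam + 1 - (lam - 1) = 2 by ring, Complex.norm_ofNat] at h4
      linarith
    have h5 : lam + 1 ≠ 0 := norm_pos_iff.1 (by linarith)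
    have ht' : (t : ℂ) ≠ 0 := by exact_mod_cast ht0.ne'
    have h6 : (-(t * lam) + t) / (-(t * lam) - t) = (lam - 1) / (lam + 1) := by
      rw [show -(t * lam) + t = -t * (lam - 1) by ring,
        show -(t * lam) - t = -t * (lam + 1) by ring, mul_div_mul_left _ _ (neg_ne_zero.2 ht')]
    refine le_of_sq_le_sq ?_ hη.le
    rw [hJ, h1, hG0, h6, sqNorm]
    simp only [norm_zero, norm_div]
    have h7 : ‖lam - 1‖ / ‖lam + 1‖ ≤ η := by
      rw [div_le_iff₀ (by linarith)]
      nlinarith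
    have := pow_le_pow_left₀ (by positivity) h7 2
    linarith
  have hc0 : ((1 + 2 * η : ℝ) : ℂ) ≠ 0 := Complex.ofReal_ne_zero.2 (by positivity)
  have hcn : ‖((1 + 2 * η : ℝ) : ℂ)⁻¹‖ = (1 + 2 * η)⁻¹ := by
    rw [norm_inv, Complex.norm_real, Real.norm_of_nonneg (by positivity)]
  -- Recentring at the image of `z₀` enlarges the outer radius to `1 + 2η` and shrinks the inner one
  -- to `1 - 2η`; the dilation normalises the outer one.
  refine ⟨fun z => ((1 + 2 * η : ℝ) : ℂ)⁻¹ • (J (G (Ψ (z - x))) - J (G (Ψ (z₀ - x)))), ?_, ?_, ?_, ?_⟩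
  · exact (holEmb_const_smul (inv_ne_zero hc0) univ).comp ((holEmb_sub_const _ univ).comp hF (mapsTo_univ _ _)
      isOpen_univ) (mapsTo_univ _ _) isOpen_univ
  · intro z hz
    have h1 : ‖J (G (Ψ (z - x)))‖ < 1 + η := by
      refine lt_of_pow_lt_pow_left₀ 2 (by positivity) ?_
      rw [hJ]
      exact hGup _ ⟨z, hz, rfl⟩
    rw [mem_ball_zero_iff, norm_smul, hcn, inv_mul_lt_iff₀ (by positivity)]
    linarith [norm_sub_le (J (G (Ψ (z - x)))) (J (G (Ψ (z₀ - x))))]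
  · simp
  · intro y hy
    rw [mem_ball_zero_iff, lt_div_iff₀ (by positivity)] at hy
    set y' := ((1 + 2 * η : ℝ) : ℂ) • y + J (G (Ψ (z₀ - x))) with hy'
    have h1 : ‖y'‖ < 1 - η := by
      have := norm_add_le (((1 + 2 * η : ℝ) : ℂ) • y) (J (G (Ψ (z₀ - x))))
      rw [norm_smul, Complex.norm_real, Real.norm_of_nonneg (by positivity)] at this
      linarith
    obtain ⟨_, ⟨z, hz, rfl⟩, hz'⟩ := hGlow (J.symm y') (by
      rw [← hJ, J.apply_symm_apply]
      exact pow_lt_pow_left₀ h1 (norm_nonneg _) two_ne_zero)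
    refine ⟨z, hz, ?_⟩
    simp only at hz' ⊢
    rw [hz', J.apply_symm_apply, hy', add_sub_cancel_right, smul_smul,
      inv_mul_cancel₀ hc0, one_smul]

/-! ### Bounds on the squeezing function and conclusion -/

/-- A unit vector, which exists as `n ≠ 0`, is not in the image. The bound keeps the suprema from
taking the default value of `sSup` on unbounded sets. -/
theorem bddAbove_radii [NeZero n] {f : Cn n → Cn n} (hf : MapsTo f D (Metric.ball 0 1)) :
    ∀ r ∈ {r : ℝ | 0 < r ∧ Metric.ball (0 : Cn n) r ⊆ f '' D}, r ≤ 1 := by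
  rintro r ⟨hr, hsub⟩
  by_contra! hcon
  have h1 : ‖EuclideanSpace.single (0 : Fin n) (1 : ℂ)‖ = 1 := by simp
  have h2 : EuclideanSpace.single (0 : Fin n) (1 : ℂ) ∈ Metric.ball (0 : Cn n) r := by
    rw [mem_ball_zero_iff, h1]
    exact hcon
  obtain ⟨z, hz, hz'⟩ := hsub h2
  have := hf hz
  rw [hz', mem_ball_zero_iff, h1] at this
  exact lt_irrefl _ this

theorem squeezingNumberOf_le_one [NeZero n] {f : Cn n → Cn n}
    (hf : MapsTo f D (Metric.ball 0 1)) : squeezingNumberOf D f ≤ 1 :=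
  Real.sSup_le (bddAbove_radii hf) zero_le_one

theorem squeezingFunction_le_one [NeZero n] (z : Cn n) : squeezingFunction D z ≤ 1 := by
  refine Real.sSup_le ?_ zero_le_one
  rintro _ ⟨f, hf, rfl⟩
  exact squeezingNumberOf_le_one hf.mapsTo

theorem le_squeezingFunction [NeZero n] {z : Cn n} {f : Cn n → Cn n}
    (hf : IsEmbeddingIntoBall D z f) {r : ℝ} (hr : 0 < r) (h : Metric.ball 0 r ⊆ f '' D) :
    r ≤ squeezingFunction D z := by
  have h1 : r ≤ squeezingNumberOf D f := le_csSup ⟨1, bddAbove_radii hf.mapsTo⟩ ⟨hr, h⟩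
  refine h1.trans (le_csSup ⟨1, ?_⟩ ⟨f, hf, rfl⟩)
  rintro _ ⟨g, hg, rfl⟩
  exact squeezingNumberOf_le_one hg.mapsTo

end Domain

theorem mainTheorem1 {n : ℕ} (D : Set (Cn n)) (hD : IsBoundedDomain D) (p : Cn n)
    (hp : IsGloballyStronglyConvexPoint D p) :
    Filter.Tendsto (squeezingFunction D) (𝓝[D] p) (𝓝 1) := by
  -- In dimension `0` every derivative vanishes, which contradicts `dρ ≠ 0`.
  have hn : NeZero n := by
    refine ⟨?_⟩
    rintro rfl
    obtain ⟨-, U, ρ, hU, -⟩ := hp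
    exact hU.fderiv_ne_zero p hU.mem (Subsingleton.elim _ _)
  rw [Metric.tendsto_nhds]
  intro ε hε
  obtain ⟨η, hη, hη1, hηε⟩ : ∃ η : ℝ, 0 < η ∧ η ≤ 1 / 4 ∧ 4 * η < ε :=
    ⟨min (1 / 4) (ε / 8), by positivity, min_le_left _ _, by
      linarith [min_le_right (1 / 4) (ε / 8)]⟩
  filter_upwards [hp.eventually_exists_holEmb hD hη (by linarith)] with z hz
  obtain ⟨f, hf, hmaps, hfz, hball⟩ := hz
  have h1 : 0 < (1 - 2 * η) / (1 + 2 * η) := div_pos (by linarith) (by linarith)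
  have h2 := le_squeezingFunction ⟨hf.1, hf.fderiv_injective hD.isOpen,
    hf.isOpenEmbedding hD.isOpen, hmaps, hfz⟩ h1 hball
  have h3 : 1 - 4 * η ≤ (1 - 2 * η) / (1 + 2 * η) := by
    rw [le_div_iff₀ (by linarith)]
    nlinarith
  have h4 := squeezingFunction_le_one (D := D) z
  rw [Real.dist_eq, abs_lt]
  constructor <;> linarith
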